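/- There are universal constants $K,c>0$ such that the following holds. Let $d\ge 0$, $\mathcal X\subseteq\mathbb R^d$, $\sigma,\varepsilon>0$, and let $\mathcal H\subseteq\{\pm1\}^{\mathbb R^d}$ be a nonempty class of finite VC dimension $v=\mathsf{vc}(\mathcal H)$ which is measurable in the usual sense of uniform convergence: every $h\in\mathcal H$ is Lebesgue measurable, and for all $n$ and $b\in\{\pm1\}^n$ the set $\{(p_1,\dots,p_n)\in(\mathbb R^d)^n:\exists h\in\mathcal H\ \forall i\ h(p_i)=b_i\}$ is Lebesgue measurable. For labelled points $(x_t,y_t)_{t=1}^T$ in $\mathcal X\times\{\pm1\}$ put $$\mathsf{OPT}^{\sigma,\varepsilon}_{\mathrm{gauss}}=\min_{h\in\mathcal H}\sum_{t=1}^T\mathbf 1\big[\,y_t\,\mathbb E_{z\sim N(0,I_d)}[h(x_t+\sigma z)]\le\varepsilon\,\big].$$ Consider the following online algorithm. Put $\tilde\varepsilon=\varepsilon/4$ and $\gamma=\sigma\tilde\varepsilon/\sqrt{2/\pi}=\sqrt{\pi/32}\,\sigma\varepsilon$. Take a finite $\mathcal Z\subset\mathbb R^d$ and a map $\phi:\mathcal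 X\to\mathcal Z$ with $\|x-\phi(x)\|_2\le\gamma$ for all $x\in\mathcal X$. Take an integer $M$ with $1\le M\le\lceil K\max(v,1)/\tilde\varepsilon^2\rceil$ and, for each $\tilde x\in\mathcal Z$, points $z_1,\dots,z_M\in\mathbb R^d$ (depending on $\tilde x$) such that $$\Big|\Pr_{z\sim N(0,I_d)}\{h(\tilde x+\sigma z)=y\}-\tfrac1M\sum_{i=1}^M\mathbf 1[h(\tilde x+\sigma z_i)=y]\Big|\le\tilde\varepsilon\qquad\text{for all }y\in\{\pm1\},\ h\in\mathcal H. \tag{$*$}$$ Let $\mathcal S$ be the set of all points $\tilde x+\sigma z_i$, let $\mathcal H|_{\mathcal S}$ be the (finite) set of restrictions of members of $\mathcal H$ to $\mathcal S$, let $\eta=\sqrt{8\ln|\mathcal H|_{\mathcal S}|/T}$, and let $P_1$ be uniform on $\mathcal H|_{\mathcal S}$. In round $t=1,\dots,T$, on receiving $x_t$, put $\tilde x_t=\phi(x_t)$, draw $h\sim P_t$, and predict $\hat y_t=+1$ if $\frac1M\sum_i\mathbf 1[h(\tilde x_t+\sigma z_i)=+1]\ge\frac12$ and $\hat y_t=-1$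 otherwise; when $y_t$ is revealed, update $$P_{t+1}(h)\propto P_t(h)\exp\Big(-\eta\,\mathbf 1\Big[\tfrac1M\sum_i\mathbf 1[h(\tilde x_t+\sigma z_i)\ne y_t]\ge\tfrac12\Big]\Big).$$ Then: 1. For every finite $\mathcal Z$ and $\phi$ as above, an integer $M$ and points as in $(*)$ exist; and for every choice of $\mathcal Z$, $\phi$, $M$ and such points, every $T$ and every sequence $(x_t,y_t)_{t=1}^T$ in $\mathcal X\times\{\pm1\}$, $$\sum_{t=1}^T\mathbb E\,\mathbf 1[\hat y_t\ne y_t]-\mathsf{OPT}^{\sigma,\varepsilon}_{\mathrm{gauss}}\le\sqrt{T\cdot v\cdot\ln\frac{c\,e\,|\mathcal Z|}{\varepsilon^2}}.$$ 2. Consequently, if the covering number $N=|\mathsf C(\mathcal X,\|\cdot\|_2,\sqrt{\pi/32}\,\sigma\varepsilon)|$ (the least size of a cover of $\mathcal X$ by closed balls of this radius centred in $\mathcal X$) is finite, then $\mathcal Z\subseteq\mathcal X$ can be taken with $|\mathcal Z|=N$ (with a corresponding $\phi$); $M$ and points as in $(*)$ exist, and for every choice of them the algorithm guarantees, for all $T$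 and all sequences, $$\sum_{t=1}^T\mathbb E\,\mathbf 1[\hat y_t\ne y_t]-\mathsf{OPT}^{\sigma,\varepsilon}_{\mathrm{gauss}}\le\sqrt{T\cdot v\cdot\ln\frac{c\,e\,N}{\varepsilon^2}}.$$ (The root is read as $0$ if its argument is negative.) -/

import Mathlib

open MeasureTheory ProbabilityTheory

namespace GaussSmooth

/-- Euclidean space `ℝ^d`. -/
abbrev Euc (d : ℕ) : Type := EuclideanSpace ℝ (Fin d)

/-- Labels: the two-element type `{1, -1}`, realised as the units of `ℤ`. -/
abbrev Label : Type := ℤˣ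

/-- The real number `1` or `-1` of a label. -/
def Label.toReal (y : Label) : ℝ := ((y : ℤ) : ℝ)

/-- `H` shatters the finite set `S`: every labelling of `S` is realised by a member of `H`. -/
def Shatters {α : Type*} (H : Set (α → Label)) (S : Finset α) : Prop :=
  ∀ b : α → Label, ∃ h ∈ H, ∀ x ∈ S, h x = b x

/-- The VC dimension of `H` (`⊤` if arbitrarily large finite sets are shattered). -/
noncomputable def vcDim {α : Type*} (H : Set (α → Label)) : ℕ∞ :=
  ⨆ (S : Finset α) (_ : Shatters H S), (S.card : ℕ∞)

/-- The measurability of a hypothesis class on `ℝ^d` that uniform convergence presupposes: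
every member is Lebesgue measurable, and for every `n` and every `b ∈ {1, -1}^n` the set of
`n`-tuples of points that some member of `H` labels by `b` is a Lebesgue measurable subset
of `(ℝ^d)^n`. -/
def MeasurableClass {d : ℕ} (H : Set (Euc d → Label)) : Prop :=
  (∀ h ∈ H, NullMeasurableSet {x : Euc d | h x = 1} volume) ∧
  ∀ (n : ℕ) (b : Fin n → Label),
    NullMeasurableSet {p : Fin n → Euc d | ∃ h ∈ H, ∀ i, h (p i) = b i} volume

/-- The Gaussian-smoothed benchmark
`min_{h ∈ H} ∑_{t < T} 1[y_t · 𝔼_{z ∼ N(0, I_d)} h (x_t + σ z) ≤ ε]`. -/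
noncomputable def optGauss {d : ℕ} (H : Set (Euc d → Label)) (σ ε : ℝ) (T : ℕ)
    (x : ℕ → Euc d) (y : ℕ → Label) : ℕ :=
  sInf ((fun h : Euc d → Label => ∑ t ∈ Finset.range T,
    if (y t).toReal * ∫ z, (h (x t + σ • z)).toReal ∂(stdGaussian (Euc d)) ≤ ε
      then 1 else 0) '' H)

/-- Multiplicative Weights on a finite set `F` of experts with learning rate `η` and losses `ℓ`:
`mwProb F η ℓ t` is the distribution over `F` played in round `t` (rounds are numbered from `0`).
It depends only on the losses of the rounds before `t`. -/
noncomputable def mwProb {ι : Type*} (F : Finset ι) (η : ℝ) (ℓ : ℕ → ι → ℝ) : ℕ → ι → ℝ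
  | 0, _ => 1 / (F.card : ℝ)
  | t + 1, f => mwProb F η ℓ t f * Real.exp (-η * ℓ t f) /
      ∑ f' ∈ F, mwProb F η ℓ t f' * Real.exp (-η * ℓ t f')

section Algorithm

variable {d : ℕ}

/-- The scale of the cover: `γ = σ ε' / √(2/π)` with `ε' = ε / 4`. -/
noncomputable def coverScale (σ ε : ℝ) : ℝ := σ * (ε / 4) / Real.sqrt (2 / Real.pi)

/-- The set of noisy points `x' + σ z_i`, for `x'` in the cover `Z` and `i < M`
(the points `z_i = z x' i` may depend on `x'`). -/
def noisyPoints (σ : ℝ) (Z : Finset (Euc d)) (M : ℕ) (z : Z → Fin M → Euc d) : Set (Euc d) :=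
  Set.range fun p : Z × Fin M => (p.1 : Euc d) + σ • z p.1 p.2

instance (σ : ℝ) (Z : Finset (Euc d)) (M : ℕ) (z : Z → Fin M → Euc d) :
    Finite (noisyPoints σ Z M z) :=
  Set.finite_range _

/-- The noisy point `x' + σ z_i` as an element of the set of noisy points. -/
def noisyPoint (σ : ℝ) (Z : Finset (Euc d)) (M : ℕ) (z : Z → Fin M → Euc d)
    (x' : Z) (i : Fin M) : noisyPoints σ Z M z :=
  ⟨(x' : Euc d) + σ • z x' i, (x', i), rfl⟩

/-- The points `z x' 1, …, z x' M` form, for every point `x'` of `Z`, an `ε/4`-approximation of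
the Gaussian for `H` around `x'`, and `M = O(vc / (ε/4)^2)` with constant `K`.
The number `vc` is replaced by `1` if it is `0`, and the bound on `M` is rounded up. -/
def IsGaussApprox (H : Set (Euc d → Label)) (σ ε K : ℝ) (Z : Finset (Euc d)) (M : ℕ)
    (z : Z → Fin M → Euc d) : Prop :=
  0 < M ∧ M ≤ ⌈K * (max (vcDim H).toNat 1 : ℕ) / (ε / 4) ^ 2⌉₊ ∧
  ∀ (x' : Z) (y : Label), ∀ h ∈ H,
    |(stdGaussian (Euc d)).real {u | h ((x' : Euc d) + σ • u) = y}
      - 1 / (M : ℝ) * ∑ i, (if h ((x' : Euc d) + σ • z x' i) = y then (1 : ℝ) else 0)| ≤ ε / 4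

/-- The experts: the restrictions to the noisy points of the members of `H`. -/
noncomputable def experts (H : Set (Euc d → Label)) (σ : ℝ) (Z : Finset (Euc d)) (M : ℕ)
    (z : Z → Fin M → Euc d) : Finset (noisyPoints σ Z M z → Label) :=
  (Set.toFinite ((fun (h : Euc d → Label) (p : noisyPoints σ Z M z) => h p) '' H)).toFinset

/-- The label that the expert `g` predicts at the point `x'` of the cover: `1` if at least half of
the noisy points around `x'` are labelled `1` by `g`, and `-1` otherwise. -/
noncomputable def predict (σ : ℝ) (Z : Finset (Euc d)) (M : ℕ) (z : Z → Fin M → Euc d)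
    (g : noisyPoints σ Z M z → Label) (x' : Z) : Label :=
  if 1 / 2 ≤ 1 / (M : ℝ) *
      ∑ i, (if g (noisyPoint σ Z M z x' i) = 1 then (1 : ℝ) else 0) then 1 else -1

/-- The loss by which the expert `g` is updated: `1` if at least half of the noisy points around
`x'` are not labelled `y` by `g`, and `0` otherwise. -/
noncomputable def loss (σ : ℝ) (Z : Finset (Euc d)) (M : ℕ) (z : Z → Fin M → Euc d)
    (g : noisyPoints σ Z M z → Label) (x' : Z) (y : Label) : ℝ :=
  if 1 / 2 ≤ 1 / (M : ℝ) *
      ∑ i, (if g (noisyPoint σ Z M z x' i) ≠ y then (1 : ℝ) else 0) then 1 else 0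

/-- The learning rate `√(8 log N / T)`, where `N` is the number of experts. -/
noncomputable def rate (H : Set (Euc d → Label)) (σ : ℝ) (Z : Finset (Euc d)) (M : ℕ)
    (z : Z → Fin M → Euc d) (T : ℕ) : ℝ :=
  Real.sqrt (8 * Real.log ((experts H σ Z M z).card : ℝ) / (T : ℝ))

/-- The expected number `∑_{t < T} 𝔼 1[ŷ_t ≠ y_t]` of mistakes of the algorithm on the sequence
`(x_t, y_t)`: in round `t` it draws an expert `g` from the Multiplicative Weights distribution
and predicts `ŷ_t = predict g (φ x_t)`. -/
noncomputable def expectedMistakes {X : Set (Euc d)} (H : Set (Euc d → Label)) (σ : ℝ)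
    (Z : Finset (Euc d)) (φ : X → Z) (M : ℕ) (z : Z → Fin M → Euc d) (T : ℕ)
    (x : ℕ → X) (y : ℕ → Label) : ℝ :=
  ∑ t ∈ Finset.range T, ∑ g ∈ experts H σ Z M z,
    mwProb (experts H σ Z M z) (rate H σ Z M z T)
        (fun s g' => loss σ Z M z g' (φ (x s)) (y s)) t g *
      (if predict σ Z M z g (φ (x t)) ≠ y t then 1 else 0)

end Algorithm

/-- The regret bound `√(T · v · ln (c e N / ε²))`. -/
noncomputable def regretBound (c ε : ℝ) (T v N : ℕ) : ℝ :=
  Real.sqrt ((T : ℝ) * (v : ℝ) * Real.log (c * Real.exp 1 * (N : ℝ) / ε ^ 2))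

end GaussSmooth

namespace GaussSmooth

/-! The proof has three independent ingredients.

Uniform convergence without a logarithmic factor: `M = O(v / ε²)` points approximate the Gaussian
around a point for the whole class. After symmetrization the deviation becomes a Rademacher average
over the traces of the class on a sample. Massart's lemma alone would lose a logarithm there;
chaining over the scales `M / 4 ^ k`, with Dudley's packing bound at each scale
(`log_card_le_of_separated`), gives `O(√(v M))` in `sum_abs_rad_le`. Symmetrization turns this into
`exists_approx_sample`.

Gaussian smoothing: the shifted Gaussian has density `L = exp (⟪w, ·⟫ - ‖w‖² / 2)` with `∫ L = 1`
and `∫ L² = exp ‖w‖²`, so it is within `O(‖w‖)` of the Gaussian in total variation. Moving `x` to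
its cover point thus changes the smoothed value of any hypothesis by at most `ε / 2`, and sampling
costs another `ε / 2`. So an expert that suffers a loss comes from a hypothesis whose margin at `x`
is at most `ε` (`loss_le_indicator`).

Multiplicative Weights: every mistake is charged to a loss (`mistake_le_loss`), so the regret is at
most `√(T log n / 2)` for `n` experts. The experts are traces on at most `|Z| M` points, and
Sauer–Shelah gives `log n ≤ v log (c e |Z| / ε²)`. -/

/-! ### Sauer–Shelah and packing bounds for finite set families -/

open Finset in
/-- A Sauer–Shelah bound in exponential form. -/
lemma card_le_of_vcDim_le {β : Type*} [Fintype β] [DecidableEq β] {𝒜 : Finset (Finset β)} {v : ℕ}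
    (h : 𝒜.vcDim ≤ v) {x : ℝ} (hx : 0 < x) (hx1 : x ≤ 1) :
    (𝒜.card : ℝ) ≤ (1 / x) ^ v * Real.exp (x * Fintype.card β) := by
  have h1 : 𝒜.card ≤ ∑ k ∈ Iic v, (Fintype.card β).choose k :=
    (card_le_card_shatterer 𝒜).trans (card_shatterer_le_sum_vcDim.trans
      (sum_le_sum_of_subset (Iic_subset_Iic.2 h)))
  set n := Fintype.card β
  have h2 : (∑ k ∈ Iic v, (n.choose k : ℝ) * x ^ k) ≤ (1 + x) ^ n := by
    have : (1 + x) ^ n = ∑ k ∈ range (n + 1), (n.choose k : ℝ) * x ^ k := by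
      rw [add_comm, add_pow]; exact sum_congr rfl fun k _ => by ring
    rw [this]
    calc _ = ∑ k ∈ (Iic v).filter (· ≤ n), (n.choose k : ℝ) * x ^ k := by
          rw [sum_filter]
          refine sum_congr rfl fun k _ => ?_
          split_ifs with hk
          · rfl
          · simp [Nat.choose_eq_zero_of_lt (not_le.1 hk)]
      _ ≤ _ := by
          refine sum_le_sum_of_subset_of_nonneg (fun k hk => ?_) fun k _ _ => by positivity
          simp only [mem_filter] at hk
          simp only [mem_range]; omega
  calc (𝒜.card : ℝ) ≤ ∑ k ∈ Iic v, (n.choose k : ℝ) := by exact_mod_cast h1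
    -- Weighting by `x ^ k` costs at most `x ^ v`, and completes the partial sum to a binomial
    -- expansion; `x` stays free for later tuning.
    _ ≤ ∑ k ∈ Iic v, (1 / x) ^ v * ((n.choose k : ℝ) * x ^ k) := by
        refine sum_le_sum fun k hk => ?_
        have hk' : k ≤ v := by simpa using hk
        have : 1 ≤ (1 / x) ^ v * x ^ k := by
          rw [one_div, inv_pow, ← div_eq_inv_mul, le_div_iff₀ (by positivity), one_mul]
          exact pow_le_pow_of_le_one hx.le hx1 hk'
        nlinarith [Nat.cast_nonneg (α := ℝ) (n.choose k)]
    _ = (1 / x) ^ v * ∑ k ∈ Iic v, (n.choose k : ℝ) * x ^ k := by rw [mul_sum]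
    _ ≤ (1 / x) ^ v * Real.exp (x * n) := by
        gcongr
        refine h2.trans ?_
        rw [mul_comm, Real.exp_nat_mul]
        gcongr
        linarith [Real.add_one_le_exp x]

/-- The preimages under `f` of the members of a set family. -/
def pullback {α β : Type*} [DecidableEq α] [Fintype β] [DecidableEq β] (f : β → α)
    (𝒜 : Finset (Finset α)) : Finset (Finset β) :=
  𝒜.image fun A => Finset.univ.filter (f · ∈ A)

-- A set shattered by the preimages has its singletons cut out, so `f` is injective on it, and its
-- image is shattered by `𝒜`.
open Finset in
lemma vcDim_pullback_le {α β : Type*} [DecidableEq α] [Fintype β] [DecidableEq β] (f : β → α)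
    (𝒜 : Finset (Finset α)) : (pullback f 𝒜).vcDim ≤ 𝒜.vcDim := by
  refine Finset.sup_le fun S hS => ?_
  rw [mem_shatterer] at hS
  have key : ∀ t ⊆ S, ∃ A ∈ 𝒜, ∀ i ∈ S, f i ∈ A ↔ i ∈ t := by
    intro t ht
    obtain ⟨u, hu, hut⟩ := hS ht
    obtain ⟨A, hA, rfl⟩ := mem_image.1 hu
    refine ⟨A, hA, fun i hi => ?_⟩
    rw [← hut]; simp [hi]
  have hinj : Set.InjOn f S := by
    intro i hi j hj hij
    obtain ⟨A, -, hA⟩ := key {i} (by simpa using hi)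
    have h1 := hA i hi
    have h2 := hA j hj
    rw [hij] at h1
    have := (h2.symm.trans h1).2 (by simp)
    exact (by simpa using this : j = i).symm
  rw [← card_image_of_injOn hinj]
  refine Finset.Shatters.card_le_vcDim fun t ht => ?_
  obtain ⟨A, hA, h⟩ := key (S.filter (f · ∈ t)) (filter_subset _ _)
  refine ⟨A, hA, ?_⟩
  ext a
  simp only [mem_inter, mem_image]
  constructor
  · rintro ⟨⟨i, hi, rfl⟩, ha⟩
    have := (h i hi).1 ha
    simp at this; exact this.2
  · intro ha
    obtain ⟨i, hi, rfl⟩ := mem_image.1 (ht ha)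
    exact ⟨⟨i, hi, rfl⟩, (h i hi).2 (by simp [hi, ha])⟩

open Finset in
/-- If the members of a family differ pairwise on more than a fraction `η` of the points, then
some sample of `k` points separates them. -/
lemma exists_sample_injOn {α : Type*} [Fintype α] [DecidableEq α] {𝒜 : Finset (Finset α)}
    {η : ℝ} (h𝒜 : 𝒜.Nontrivial)
    (hsep : ∀ A ∈ 𝒜, ∀ B ∈ 𝒜, A ≠ B → η * Fintype.card α < (symmDiff A B).card) (k : ℕ)
    (hk : 2 * Real.log 𝒜.card ≤ η * k) :
    ∃ f : Fin k → α, (pullback f 𝒜).card = 𝒜.card := by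
  obtain ⟨A₀, hA₀, B₀, hB₀, hne⟩ := h𝒜
  have hM : 0 < Fintype.card α := by
    rw [Fintype.card_pos_iff]
    by_contra hcon
    rw [not_nonempty_iff] at hcon
    exact hne (Subsingleton.elim _ _)
  set M := Fintype.card α with hMdef
  have hn : 0 < 𝒜.card := card_pos.2 ⟨A₀, hA₀⟩
  -- Union bound by counting: a uniform sample misses a given difference with probability at most
  -- `exp (-η k) ≤ 1 / n²`, where `n = 𝒜.card`, and there are only `n² - n` ordered pairs.
  by_contra! hcon
  have hcover : (univ : Finset (Fin k → α)) ⊆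
      𝒜.offDiag.biUnion fun p => Fintype.piFinset fun _ => (symmDiff p.1 p.2)ᶜ := by
    intro f _
    have h1 := hcon f
    unfold pullback at h1
    rw [Ne, card_image_iff] at h1
    simp only [Set.InjOn, not_forall] at h1
    obtain ⟨A, hA, B, hB, hAB, hneAB⟩ := h1
    refine mem_biUnion.2 ⟨(A, B), by simpa using ⟨hA, hB, hneAB⟩, ?_⟩
    rw [Fintype.mem_piFinset]
    intro j
    have : j ∈ univ.filter (f · ∈ A) ↔ j ∈ univ.filter (f · ∈ B) := by rw [hAB]
    simp only [mem_filter, mem_univ, true_and] at this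
    simp only [mem_compl, mem_symmDiff]
    tauto
  have hcard := (card_le_card hcover).trans card_biUnion_le
  have h2 : ∀ p ∈ 𝒜.offDiag,
      (((Fintype.piFinset fun _ : Fin k => (symmDiff p.1 p.2)ᶜ).card : ℕ) : ℝ)
        ≤ (M : ℝ) ^ k * Real.exp (-(η * k)) := by
    rintro ⟨A, B⟩ hp
    rw [mem_offDiag] at hp
    have hs := hsep A hp.1 B hp.2.1 hp.2.2
    rw [Fintype.card_piFinset, prod_const, card_univ, Fintype.card_fin, card_compl]
    have hle : (symmDiff A B).card ≤ M := card_le_univ _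
    rw [← hMdef, Nat.cast_pow, Nat.cast_sub hle]
    rw [show -(η * k) = k * (-η) by ring, Real.exp_nat_mul, ← mul_pow]
    have h0 : (0 : ℝ) ≤ (M : ℝ) - (symmDiff A B).card := by
      rw [sub_nonneg]; exact_mod_cast hle
    refine pow_le_pow_left₀ h0 ?_ k
    have := Real.add_one_le_exp (-η)
    have hM0 : (0 : ℝ) < M := by exact_mod_cast hM
    nlinarith
  have h3 : (M : ℝ) ^ k ≤ 𝒜.offDiag.card * ((M : ℝ) ^ k * Real.exp (-(η * k))) := by
    have h4 : ((univ : Finset (Fin k → α)).card : ℝ) = (M : ℝ) ^ k := by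
      rw [card_univ]; simp [hMdef]
    rw [← h4]
    calc ((univ : Finset (Fin k → α)).card : ℝ)
        ≤ ∑ p ∈ 𝒜.offDiag,
            (((Fintype.piFinset fun _ : Fin k => (symmDiff p.1 p.2)ᶜ).card : ℕ) : ℝ) := by
          exact_mod_cast hcard
      _ ≤ ∑ p ∈ 𝒜.offDiag, ((M : ℝ) ^ k * Real.exp (-(η * k))) := sum_le_sum h2
      _ = _ := by rw [sum_const, nsmul_eq_mul, h4]
  have hn' : (0 : ℝ) < 𝒜.card := by exact_mod_cast hn
  have h5 : Real.exp (-(η * k)) ≤ 1 / ((𝒜.card : ℝ) * 𝒜.card) := by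
    rw [Real.exp_neg, ← one_div]
    refine one_div_le_one_div_of_le (by positivity) ?_
    calc (𝒜.card : ℝ) * 𝒜.card = Real.exp (2 * Real.log 𝒜.card) := by
          rw [two_mul, Real.exp_add, Real.exp_log hn']
      _ ≤ _ := Real.exp_le_exp.2 hk
  have h6 : (𝒜.offDiag.card : ℝ) = (𝒜.card : ℝ) * 𝒜.card - 𝒜.card := by
    rw [offDiag_card, Nat.cast_sub (Nat.le_mul_self _)]; push_cast; ring
  have hMk : (0 : ℝ) < (M : ℝ) ^ k := by have : (0 : ℝ) < M := by exact_mod_cast hM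
                                         positivity
  have h7 : 1 ≤ (𝒜.offDiag.card : ℝ) * Real.exp (-(η * k)) := by
    by_contra! hlt
    nlinarith
  have h8 : (𝒜.offDiag.card : ℝ) * Real.exp (-(η * k))
      ≤ (𝒜.offDiag.card : ℝ) * (1 / ((𝒜.card : ℝ) * 𝒜.card)) := by gcongr
  have h9 := h7.trans h8
  rw [mul_one_div, le_div_iff₀ (by positivity), h6] at h9
  linarith

open Finset in
/-- Dudley's bound on the packing numbers of a VC class. -/
lemma log_card_le_of_separated {α : Type*} [Fintype α] [DecidableEq α] {𝒜 : Finset (Finset α)}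
    {v : ℕ} (hv : 𝒜.vcDim ≤ v) {η : ℝ} (hη : 0 < η) (hη1 : η ≤ 1)
    (hsep : ∀ A ∈ 𝒜, ∀ B ∈ 𝒜, A ≠ B → η * Fintype.card α < (symmDiff A B).card) :
    Real.log 𝒜.card ≤ 2 * v * Real.log (4 / η) + 1 / 2 := by
  have hlog : 0 ≤ Real.log (4 / η) := Real.log_nonneg (by rw [le_div_iff₀ hη]; linarith)
  by_cases h𝒜 : 𝒜.Nontrivial
  · set k := ⌈2 * Real.log 𝒜.card / η⌉₊
    have hk1 : 2 * Real.log 𝒜.card / η ≤ k := Nat.le_ceil _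
    have hlog2 : 0 ≤ Real.log 𝒜.card := Real.log_natCast_nonneg _
    have hk2 : (k : ℝ) < 2 * Real.log 𝒜.card / η + 1 := Nat.ceil_lt_add_one (by positivity)
    rw [div_le_iff₀ hη] at hk1
    obtain ⟨f, hf⟩ := exists_sample_injOn h𝒜 hsep k (by linarith)
    -- With `x = η / 4` the exponent is about half of `log 𝒜.card`, so it can be absorbed on the
    -- left.
    have h1 := card_le_of_vcDim_le ((vcDim_pullback_le f 𝒜).trans hv) (x := η / 4)
      (by positivity) (by linarith)
    rw [hf, Fintype.card_fin] at h1
    have hpos : (0 : ℝ) < 𝒜.card := by exact_mod_cast card_pos.2 h𝒜.nonempty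
    have h2 := Real.log_le_log hpos h1
    rw [Real.log_mul (by positivity) (by positivity), Real.log_exp, Real.log_pow,
      one_div_div] at h2
    have h3 : η / 4 * k ≤ Real.log 𝒜.card / 2 + 1 / 4 := by
      have : η * k ≤ 2 * Real.log 𝒜.card + η := by
        have := mul_le_mul_of_nonneg_left hk2.le hη.le
        rwa [mul_add, mul_div_cancel₀ _ hη.ne', mul_one] at this
      linarith
    linarith
  · have : 𝒜.card ≤ 1 := by
      by_contra! h
      exact h𝒜 (one_lt_card_iff_nontrivial.1 h)
    have : Real.log 𝒜.card = 0 := by interval_cases 𝒜.card <;> simp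
    rw [this]; positivity

/-- The real sign of a Boolean. -/
def sgn (b : Bool) : ℝ := if b then 1 else -1

/-! ### Rademacher averages: Massart's lemma and chaining -/

section Rademacher

variable {α : Type*} [Fintype α] [DecidableEq α]

-- The sum over signs factors over the coordinates into terms `2 cosh (l w i)`.
open Finset in
lemma sum_exp_rademacher_le (w : α → ℝ) {m l : ℝ} (hw : ∑ i, w i ^ 2 ≤ m) :
    ∑ s : α → Bool, Real.exp (l * ∑ i, w i * sgn (s i))
      ≤ 2 ^ Fintype.card α * Real.exp (l ^ 2 * m / 2) := by
  have h1 : ∀ s : α → Bool, Real.exp (l * ∑ i, w i * sgn (s i))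
      = ∏ i, Real.exp (l * w i * sgn (s i)) := by
    intro s; rw [← Real.exp_sum, mul_sum]; simp only [mul_assoc]
  simp_rw [h1]
  rw [← Fintype.prod_sum fun i (b : Bool) => Real.exp (l * w i * sgn b)]
  have h2 : ∀ i, ∑ b : Bool, Real.exp (l * w i * sgn b) ≤ 2 * Real.exp ((l * w i) ^ 2 / 2) := by
    intro i
    have := Real.cosh_le_exp_half_sq (l * w i)
    rw [Real.cosh_eq] at this
    simp [sgn]
    linarith
  calc _ ≤ ∏ i, (2 * Real.exp ((l * w i) ^ 2 / 2)) :=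
        prod_le_prod (fun i _ => by positivity) fun i _ => h2 i
    _ = 2 ^ Fintype.card α * Real.exp (∑ i, (l * w i) ^ 2 / 2) := by
        rw [prod_mul_distrib, prod_const, card_univ, Real.exp_sum]
    _ ≤ _ := by
        gcongr
        rw [← sum_div]
        simp_rw [mul_pow]
        rw [← mul_sum]
        gcongr

open Finset in
/-- Massart's finite class lemma, for a selection `g` from a finite set. -/
lemma sum_abs_rademacher_le {ι : Type*} (J : Finset ι) (w : ι → α → ℝ) {m l : ℝ} (hl : 0 < l)
    (hw : ∀ j ∈ J, ∑ i, w j i ^ 2 ≤ m) (g : (α → Bool) → ι) (hg : ∀ s, g s ∈ J) :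
    ∑ s, |∑ i, w (g s) i * sgn (s i)|
      ≤ 2 ^ Fintype.card α * (Real.log (2 * J.card) / l + l * m / 2) := by
  have hJ : (0 : ℝ) < J.card := by exact_mod_cast card_pos.2 ⟨_, hg fun _ => true⟩
  set a := 2 * J.card * Real.exp (l ^ 2 * m / 2) with ha
  have ha0 : 0 < a := by positivity
  set X : ι → (α → Bool) → ℝ := fun j s => ∑ i, w j i * sgn (s i) with hX
  -- The tangent inequality `u + 1 ≤ exp u` at `u = l |X| - log a` replaces Jensen. The value of `a`
  -- makes the last term average to at most `1`. Summing over all of `J` removes the dependence on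
  -- `g`.
  have hpt : ∀ s, l * |X (g s) s| ≤ Real.log a - 1 +
      a⁻¹ * ∑ j ∈ J, (Real.exp (l * X j s) + Real.exp (-l * X j s)) := by
    intro s
    have h1 := Real.add_one_le_exp (l * |X (g s) s| - Real.log a)
    rw [Real.exp_sub, Real.exp_log ha0, div_eq_inv_mul] at h1
    have h2 : Real.exp (l * |X (g s) s|)
        ≤ ∑ j ∈ J, (Real.exp (l * X j s) + Real.exp (-l * X j s)) := by
      refine le_trans ?_ (single_le_sum (f := fun j => Real.exp (l * X j s) + Real.exp (-l * X j s))
        (fun j _ => by positivity) (hg s))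
      rcases abs_cases (X (g s) s) with ⟨h, -⟩ | ⟨h, -⟩ <;> rw [h]
      · linarith [Real.exp_pos (-l * X (g s) s)]
      · rw [mul_neg, ← neg_mul]; linarith [Real.exp_pos (l * X (g s) s)]
    have := mul_le_mul_of_nonneg_left h2 (inv_nonneg.2 ha0.le)
    linarith
  have hsum : ∑ s, a⁻¹ * ∑ j ∈ J, (Real.exp (l * X j s) + Real.exp (-l * X j s))
      ≤ 2 ^ Fintype.card α := by
    rw [← mul_sum, sum_comm]
    have : ∑ j ∈ J, ∑ s, (Real.exp (l * X j s) + Real.exp (-l * X j s))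
        ≤ ∑ j ∈ J, 2 * (2 ^ Fintype.card α * Real.exp (l ^ 2 * m / 2)) := by
      refine sum_le_sum fun j hj => ?_
      rw [sum_add_distrib]
      have h1 := sum_exp_rademacher_le (w j) (l := l) (hw j hj)
      have h2 := sum_exp_rademacher_le (w j) (l := -l) (hw j hj)
      rw [neg_sq] at h2
      linarith
    calc _ ≤ a⁻¹ * ∑ j ∈ J, 2 * (2 ^ Fintype.card α * Real.exp (l ^ 2 * m / 2)) := by gcongr
      _ = a⁻¹ * (a * 2 ^ Fintype.card α) := by rw [sum_const, nsmul_eq_mul, ha]; ring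
      _ = _ := by field_simp
  have hcard : (Fintype.card (α → Bool) : ℝ) = 2 ^ Fintype.card α := by simp
  have htot : l * ∑ s, |X (g s) s| ≤ 2 ^ Fintype.card α * Real.log a := by
    rw [mul_sum]
    refine (sum_le_sum fun s _ => hpt s).trans ?_
    rw [sum_add_distrib, sum_const, card_univ, nsmul_eq_mul, hcard]
    linarith
  have hloga : Real.log a = Real.log (2 * J.card) + l ^ 2 * m / 2 := by
    rw [ha, Real.log_mul (by positivity) (by positivity), Real.log_exp]
  rw [hloga] at htot
  refine le_of_mul_le_mul_left (htot.trans_eq ?_) hl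
  field_simp

/-- The Rademacher sum over a set. -/
def rad (A : Finset α) (s : α → Bool) : ℝ := ∑ i ∈ A, sgn (s i)

lemma rad_eq (A : Finset α) (s : α → Bool) :
    rad A s = ∑ i, (if i ∈ A then (1 : ℝ) else 0) * sgn (s i) := by
  simp [rad, Finset.sum_ite_mem]

open Finset in
lemma sum_sq_sub_indicator (A B : Finset α) :
    ∑ i, ((if i ∈ A then (1 : ℝ) else 0) - (if i ∈ B then 1 else 0)) ^ 2
      = ((symmDiff A B).card : ℝ) := by
  rw [card_eq_sum_ones, Nat.cast_sum, ← sum_filter_add_sum_filter_not univ (· ∈ symmDiff A B)]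
  have h1 : (univ.filter (· ∈ symmDiff A B)) = symmDiff A B := by ext; simp
  rw [h1, sum_eq_zero (s := univ.filter (¬ · ∈ symmDiff A B)), add_zero]
  · refine sum_congr rfl fun i hi => ?_
    rcases mem_symmDiff.1 hi with ⟨h, h'⟩ | ⟨h, h'⟩ <;> simp [h, h']
  · intro i hi
    simp only [mem_filter, mem_univ, true_and, mem_symmDiff] at hi
    by_cases h : i ∈ A <;> by_cases h' : i ∈ B <;> simp_all

open Finset in
/-- A maximal `r`-separated subfamily. -/
lemma exists_maximal_separated (𝒜 : Finset (Finset α)) {r : ℝ} (hr : 0 ≤ r) :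
    ∃ ℬ ⊆ 𝒜, (∀ A ∈ ℬ, ∀ B ∈ ℬ, A ≠ B → r < (symmDiff A B).card) ∧
      ∀ A ∈ 𝒜, ∃ B ∈ ℬ, ((symmDiff A B).card : ℝ) ≤ r := by
  classical
  set P := 𝒜.powerset.filter fun ℬ =>
    ∀ A ∈ ℬ, ∀ B ∈ ℬ, A ≠ B → r < (symmDiff A B).card
  obtain ⟨ℬ, hℬ, hmax⟩ := exists_max_image P card ⟨∅, by simp [P]⟩
  obtain ⟨hsub, hsep⟩ := mem_filter.1 hℬ
  rw [mem_powerset] at hsub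
  refine ⟨ℬ, hsub, hsep, fun A hA => ?_⟩
  by_contra! hcon
  have hAℬ : A ∉ ℬ := fun h => by
    have := hcon A h
    simp at this; linarith
  have hins : insert A ℬ ∈ P := by
    refine mem_filter.2 ⟨mem_powerset.2 (insert_subset hA hsub), ?_⟩
    intro B hB C hC hne
    rcases mem_insert.1 hB with rfl | hB' <;> rcases mem_insert.1 hC with rfl | hC'
    · exact absurd rfl hne
    · exact hcon C hC'
    · rw [symmDiff_comm]; exact hcon B hB'
    · exact hsep B hB' C hC' hne
  have := hmax _ hins
  rw [card_insert_of_notMem hAℬ] at this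
  omega

-- Chaining, by induction on the scale. Each member is replaced by a neighbour in a maximal
-- separated family one scale coarser, and the increment is controlled by Massart's lemma with
-- squared norm at most `M / 4 ^ k`. The increments `(4 k + 10) / 2 ^ (k + 1)` telescope to `16 - (4
-- k + 14) / 2 ^ k`.
open Finset in
lemma sum_abs_rad_le_of_separated {𝒜 : Finset (Finset α)} {v : ℕ} (hv : 𝒜.vcDim ≤ v) (hv1 : 1 ≤ v)
    (hα : 0 < Fintype.card α) (k : ℕ) :
    ∀ ℬ ⊆ 𝒜, (∀ A ∈ ℬ, ∀ B ∈ ℬ, A ≠ B → Fintype.card α / 4 ^ k < ((symmDiff A B).card : ℝ)) →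
    ∀ g : (α → Bool) → Finset α, (∀ s, g s ∈ ℬ) →
      ∑ s, |rad (g s) s| ≤ 2 ^ Fintype.card α *
        ((16 - (4 * k + 14) / 2 ^ k) * Real.sqrt (v * Fintype.card α)) := by
  set M := Fintype.card α with hM
  have hM0 : (0 : ℝ) < M := by exact_mod_cast hα
  have hv0 : (1 : ℝ) ≤ v := by exact_mod_cast hv1
  -- The constant `4` suffices because `4 log 2 + log 2 + 1 / 2 < 4`.
  have hcardlog : ∀ (j : ℕ) (ℬ : Finset (Finset α)), ℬ.Nonempty → ℬ ⊆ 𝒜 →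
      (∀ A ∈ ℬ, ∀ B ∈ ℬ, A ≠ B → M / 4 ^ j < ((symmDiff A B).card : ℝ)) →
      Real.log (2 * ℬ.card) ≤ 4 * v * (j + 1) := by
    intro j ℬ hne hsub hsep
    have h1 := log_card_le_of_separated ((vcDim_mono hsub).trans hv) (η := 1 / 4 ^ j)
      (by positivity) (by rw [div_le_one (by positivity)]; exact one_le_pow₀ (by norm_num))
      (fun A hA B hB hAB => by rw [div_mul_eq_mul_div, one_mul]; exact hsep A hA B hB hAB)
    have h2 : Real.log (4 / (1 / 4 ^ j)) = (j + 1) * (2 * Real.log 2) := by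
      rw [div_div_eq_mul_div, div_one, ← pow_succ', Real.log_pow,
        show (4 : ℝ) = 2 ^ 2 by norm_num, Real.log_pow]
      push_cast; ring
    have h3 := Real.log_two_lt_d9
    have hpos : (0 : ℝ) < ℬ.card := by exact_mod_cast card_pos.2 hne
    rw [Real.log_mul two_ne_zero hpos.ne']
    rw [h2] at h1
    have h4 : (1 : ℝ) ≤ v * (j + 1) := by
      have : (0 : ℝ) ≤ j := Nat.cast_nonneg j
      nlinarith
    have h5 : v * (j + 1) * Real.log 2 ≤ v * (j + 1) * 0.6931471808 := by gcongr
    nlinarith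
  have hsqM : Real.sqrt (v * M) * Real.sqrt (v * M) = v * M :=
    Real.mul_self_sqrt (by positivity)
  have hR : 0 < Real.sqrt (v * M) := Real.sqrt_pos.2 (by positivity)
  set R := Real.sqrt (v * M)
  induction k with
  | zero =>
    intro ℬ hsub hsep g hg
    -- No two subsets differ on more than `M` points, so at the coarsest scale a single set remains.
    have hone : ℬ.card = 1 := by
      refine le_antisymm (card_le_one.2 fun A hA B hB => ?_) (card_pos.2 ⟨_, hg fun _ => true⟩)
      by_contra hne
      have h1 := hsep A hA B hB hne
      have h2 : ((symmDiff A B).card : ℝ) ≤ M := by exact_mod_cast card_le_univ _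
      rw [pow_zero, div_one] at h1
      linarith
    have h := sum_abs_rademacher_le ℬ (fun A i => if i ∈ A then (1 : ℝ) else 0) (m := M)
      (l := 1 / R) (by positivity) (fun A _ => by
        calc _ ≤ ∑ i : α, (1 : ℝ) := sum_le_sum fun i _ => by split_ifs <;> norm_num
          _ = M := by simp [hM]) g hg
    simp_rw [← rad_eq] at h
    refine h.trans ?_
    gcongr
    rw [hone]
    have h3 := Real.log_two_lt_d9
    have h4 : (M : ℝ) / R ≤ R := by
      rw [div_le_iff₀ hR, hsqM]; nlinarith
    have h5 : 1 / R * M / 2 = (M / R) / 2 := by ring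
    have h6 : Real.log 2 * R ≤ 0.6931471808 * R := by gcongr
    rw [h5]
    simp
    linarith
  | succ k ih =>
    intro ℬ hsub hsep g hg
    have hne : ℬ.Nonempty := ⟨_, hg fun _ => true⟩
    obtain ⟨𝒞, hC, hCsep, hCcov⟩ := exists_maximal_separated 𝒜 (r := M / 4 ^ k) (by positivity)
    have hCcov' : ∀ A, ∃ B, A ∈ 𝒜 → B ∈ 𝒞 ∧ ((symmDiff A B).card : ℝ) ≤ M / 4 ^ k := by
      intro A
      by_cases hA : A ∈ 𝒜
      · obtain ⟨B, hB⟩ := hCcov A hA; exact ⟨B, fun _ => hB⟩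
      · exact ⟨A, fun h => absurd h hA⟩
    choose π hπ using hCcov'
    have hprev := ih 𝒞 hC hCsep (fun s => π (g s)) fun s => (hπ _ (hsub (hg s))).1
    have hincr := sum_abs_rademacher_le ℬ
      (fun A i => (if i ∈ A then (1 : ℝ) else 0) - (if i ∈ π A then 1 else 0)) (m := M / 4 ^ k)
      (l := 2 ^ (k + 1) * (v / R)) (by positivity)
      (fun A hA => by rw [sum_sq_sub_indicator]; exact (hπ A (hsub hA)).2) g hg
    have htri : ∑ s, |rad (g s) s| ≤ ∑ s, |rad (π (g s)) s| +
        ∑ s, |∑ i, ((if i ∈ g s then (1 : ℝ) else 0) - (if i ∈ π (g s) then 1 else 0)) * sgn (s i)|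
        := by
      rw [← sum_add_distrib]
      refine sum_le_sum fun s _ => ?_
      simp_rw [sub_mul, sum_sub_distrib, ← rad_eq]
      have := abs_add_le (rad (π (g s)) s) (rad (g s) s - rad (π (g s)) s)
      rwa [add_sub_cancel] at this
    have hlog := hcardlog (k + 1) ℬ hne hsub hsep
    have hb1 : Real.log (2 * ℬ.card) / (2 ^ (k + 1) * (v / R))
        ≤ 4 * (k + 2) / 2 ^ (k + 1) * R := by
      rw [div_le_iff₀ (by positivity)]
      refine hlog.trans_eq ?_
      push_cast
      field_simp
      ring
    have hb2 : 2 ^ (k + 1) * (v / R) * (M / 4 ^ k) / 2 = 2 / 2 ^ (k + 1) * R := by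
      rw [show (4 : ℝ) ^ k = 2 ^ k * 2 ^ k by rw [← mul_pow]; norm_num, pow_succ]
      field_simp
      linarith
    rw [hb2] at hincr
    have hfin : (16 - (4 * k + 14) / 2 ^ k) * R + (4 * (k + 2) / 2 ^ (k + 1) * R +
        2 / 2 ^ (k + 1) * R) = (16 - (4 * (k + 1 : ℕ) + 14) / 2 ^ (k + 1)) * R := by
      rw [pow_succ]; push_cast; field_simp; ring
    rw [← hfin, mul_add]
    refine htri.trans (add_le_add hprev (hincr.trans ?_))
    gcongr

open Finset in
/-- The Rademacher complexity of a VC class is `O(√(v M))`. -/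
theorem sum_abs_rad_le {𝒜 : Finset (Finset α)} {v : ℕ} (hv : 𝒜.vcDim ≤ v) (hv1 : 1 ≤ v)
    (g : (α → Bool) → Finset α) (hg : ∀ s, g s ∈ 𝒜) :
    ∑ s, |rad (g s) s| ≤ 2 ^ Fintype.card α * (16 * Real.sqrt (v * Fintype.card α)) := by
  rcases Nat.eq_zero_or_pos (Fintype.card α) with h0 | hα
  · have : IsEmpty α := Fintype.card_eq_zero_iff.1 h0
    simp [rad, eq_empty_of_isEmpty]
  -- Once `4 ^ k` exceeds the number of points, distinct sets are separated at scale `k`, so the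
  -- chain reaches all of `𝒜`.
  obtain ⟨k, hk⟩ := pow_unbounded_of_one_lt (Fintype.card α : ℝ) (by norm_num : (1 : ℝ) < 4)
  refine (sum_abs_rad_le_of_separated hv hv1 hα k 𝒜 subset_rfl (fun A _ B _ hne => ?_) g hg).trans
    ?_
  · have h1 : (1 : ℝ) ≤ (symmDiff A B).card := by
      have : 0 < (symmDiff A B).card := by
        rw [card_pos, nonempty_iff_ne_empty]
        simpa [← bot_eq_empty, symmDiff_eq_bot] using hne
      exact_mod_cast this
    refine lt_of_lt_of_le ?_ h1
    rwa [div_lt_one (by positivity)]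
  · gcongr
    have : (0 : ℝ) ≤ (4 * k + 14) / 2 ^ k := by positivity
    linarith

end Rademacher

/-! ### Traces of a class on a sample -/

section Trace

variable {X : Type*} {β : Type*} [Fintype β] [DecidableEq β]

open Finset in
open scoped Classical in
/-- The sets of indices of points of a sample that the members of a class label by `1`. -/
noncomputable def traces (H : Set (X → Label)) (p : β → X) : Finset (Finset β) :=
  univ.filter fun A => ∃ h ∈ H, A = univ.filter fun i => h (p i) = 1

lemma label_ne_one_iff (y : Label) : y ≠ 1 ↔ y = -1 := by
  rcases Int.units_eq_one_or y with rfl | rfl <;> decide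

open Finset in
open scoped Classical in
lemma vcDim_traces_le {H : Set (X → Label)} (hH : vcDim H ≠ ⊤) (p : β → X) :
    (traces H p).vcDim ≤ (vcDim H).toNat := by
  refine Finset.sup_le fun S hS => ?_
  rw [mem_shatterer] at hS
  have key : ∀ t ⊆ S, ∃ h ∈ H, ∀ i ∈ S, h (p i) = 1 ↔ i ∈ t := by
    intro t ht
    obtain ⟨u, hu, hut⟩ := hS ht
    obtain ⟨h, hh, rfl⟩ := (mem_filter.1 hu).2
    refine ⟨h, hh, fun i hi => ?_⟩
    rw [← hut]; simp [hi]
  have hinj : Set.InjOn p S := by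
    intro i hi j hj hij
    obtain ⟨h, -, hh⟩ := key {i} (by simpa using hi)
    have h1 := hh i hi
    have h2 := hh j hj
    rw [hij] at h1
    have := (h2.symm.trans h1).2 (by simp)
    exact (by simpa using this : j = i).symm
  rw [← card_image_of_injOn hinj]
  have hsh : Shatters H (S.image p) := by
    intro b
    obtain ⟨h, hh, hb⟩ := key (S.filter fun i => b (p i) = 1) (filter_subset _ _)
    refine ⟨h, hh, fun x hx => ?_⟩
    obtain ⟨i, hi, rfl⟩ := mem_image.1 hx
    have h1 := hb i hi
    simp only [mem_filter, hi, true_and] at h1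
    by_cases h2 : b (p i) = 1
    · rw [h2, h1.2 h2]
    · rw [(label_ne_one_iff _).1 h2, (label_ne_one_iff _).1 (mt h1.1 h2)]
  have : (((S.image p).card : ℕ) : ℕ∞) ≤ vcDim H := le_iSup₂_of_le (S.image p) hsh le_rfl
  rw [← ENat.natCast_toNat hH] at this
  exact_mod_cast this

end Trace

/-! ### Symmetrization by exchanging the halves of a double sample -/

section Symmetrization

variable {X : Type*} {M : ℕ}

/-- The difference of the empirical frequencies of the label `1` in the two halves of a
labelled double sample. -/
noncomputable def gap (b : Fin M ⊕ Fin M → Label) : ℝ :=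
  1 / (M : ℝ) * ∑ i, ((if b (.inl i) = 1 then (1 : ℝ) else 0) - if b (.inr i) = 1 then 1 else 0)

/-- The labellings of a double sample by the members of a class. -/
def patterns (H : Set (X → Label)) (q : Fin M ⊕ Fin M → X) : Set (Fin M ⊕ Fin M → Label) :=
  {b | ∃ h ∈ H, ∀ i, h (q i) = b i}

/-- The largest gap of a set of labellings of a double sample. -/
noncomputable def maxGap (B : Set (Fin M ⊕ Fin M → Label)) : ℝ := sSup ((fun b => |gap b|) '' B)

lemma abs_gap_le_one (b : Fin M ⊕ Fin M → Label) : |gap b| ≤ 1 := by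
  rcases Nat.eq_zero_or_pos M with rfl | hM
  · simp [gap]
  have hM' : (0 : ℝ) < M := by exact_mod_cast hM
  rw [gap, abs_mul, abs_of_pos (by positivity), one_div_mul_eq_div, div_le_one hM']
  refine (Finset.abs_sum_le_sum_abs _ _).trans ?_
  calc _ ≤ ∑ i : Fin M, (1 : ℝ) := Finset.sum_le_sum fun i _ => by split_ifs <;> norm_num
    _ = M := by simp

lemma abs_gap_le_maxGap {B : Set (Fin M ⊕ Fin M → Label)} {b} (hb : b ∈ B) :
    |gap b| ≤ maxGap B :=
  le_csSup (Set.toFinite _).bddAbove (Set.mem_image_of_mem _ hb)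

lemma exists_abs_gap_eq_maxGap {B : Set (Fin M ⊕ Fin M → Label)} (hB : B.Nonempty) :
    ∃ b ∈ B, |gap b| = maxGap B :=
  (hB.image _).csSup_mem (Set.toFinite _)

lemma patterns_nonempty {H : Set (X → Label)} (hH : H.Nonempty) (q : Fin M ⊕ Fin M → X) :
    (patterns H q).Nonempty :=
  let ⟨h, hh⟩ := hH
  ⟨fun i => h (q i), h, hh, fun _ => rfl⟩

lemma maxGap_mem_Icc {H : Set (X → Label)} (hne : H.Nonempty) (q : Fin M ⊕ Fin M → X) :
    maxGap (patterns H q) ∈ Set.Icc (0 : ℝ) 1 := by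
  obtain ⟨b, -, hb⟩ := exists_abs_gap_eq_maxGap (patterns_nonempty hne q)
  rw [← hb]
  exact ⟨abs_nonneg _, abs_gap_le_one b⟩

/-- The permutation of a double sample that exchanges the `i`-th points of the halves for all `i`
with `s i = false`. -/
def swapHalves (s : Fin M → Bool) : Equiv.Perm (Fin M ⊕ Fin M) :=
  Function.Involutive.toPerm
    (fun k => match k with
      | .inl i => if s i then .inl i else .inr i
      | .inr i => if s i then .inr i else .inl i)
    (by rintro (i | i) <;> by_cases h : s i <;> simp [h])

lemma swapHalves_inl (s : Fin M → Bool) (i : Fin M) :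
    swapHalves s (.inl i) = if s i then .inl i else .inr i := rfl

lemma swapHalves_inr (s : Fin M → Bool) (i : Fin M) :
    swapHalves s (.inr i) = if s i then .inr i else .inl i := rfl

open Finset in
open scoped Classical in
/-- Averaged over the exchanges of the halves, the largest gap of a VC class is `O(√(v / M))`. -/
lemma sum_maxGap_swap_le {H : Set (X → Label)} (hne : H.Nonempty) (hH : vcDim H ≠ ⊤)
    (q : Fin M ⊕ Fin M → X) :
    ∑ s : Fin M → Bool, maxGap (patterns H (q ∘ swapHalves s))
      ≤ 2 ^ M * (32 * Real.sqrt ((max (vcDim H).toNat 1 : ℕ) * M) / M) := by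
  have h1 : ∀ s : Fin M → Bool, ∃ h ∈ H,
      maxGap (patterns H (q ∘ swapHalves s)) = |gap fun k => h (q (swapHalves s k))| := by
    intro s
    obtain ⟨b, ⟨h, hh, hb⟩, hbe⟩ := exists_abs_gap_eq_maxGap
      (patterns_nonempty hne (q ∘ swapHalves s))
    refine ⟨h, hh, ?_⟩
    rw [← hbe]
    congr 2
    exact (funext hb).symm
  choose h hh hmax using h1
  set A : (Fin M → Bool) → Finset (Fin M) := fun s => univ.filter fun i => h s (q (.inl i)) = 1
  set A' : (Fin M → Bool) → Finset (Fin M) := fun s => univ.filter fun i => h s (q (.inr i)) = 1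
  have hA : ∀ s, A s ∈ traces H (fun i => q (.inl i)) := fun s =>
    mem_filter.2 ⟨mem_univ _, h s, hh s, rfl⟩
  have hA' : ∀ s, A' s ∈ traces H (fun i => q (.inr i)) := fun s =>
    mem_filter.2 ⟨mem_univ _, h s, hh s, rfl⟩
  have hb := sum_abs_rad_le ((vcDim_traces_le hH _).trans (le_max_left _ 1)) (le_max_right _ _) A hA
  have hb' := sum_abs_rad_le ((vcDim_traces_le hH _).trans (le_max_left _ 1)) (le_max_right _ _)
    A' hA'
  rw [Fintype.card_fin] at hb hb'
  have hpt : ∀ s, maxGap (patterns H (q ∘ swapHalves s))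
      ≤ 1 / (M : ℝ) * (|rad (A s) s| + |rad (A' s) s|) := by
    intro s
    -- An exchange flips the sign of one summand, so the gap is a difference of Rademacher sums over
    -- traces on the two fixed halves; each contributes the constant `16`.
    have hgap : gap (fun k => h s (q (swapHalves s k)))
        = 1 / (M : ℝ) * (rad (A s) s - rad (A' s) s) := by
      rw [gap, rad_eq, rad_eq, ← sum_sub_distrib]
      congr 1
      refine sum_congr rfl fun i _ => ?_
      rw [swapHalves_inl, swapHalves_inr]
      by_cases hs : s i <;> simp [hs, A, A', sgn]
      ring
    rw [hmax, hgap, abs_mul, abs_of_nonneg (by positivity : (0 : ℝ) ≤ 1 / (M : ℝ))]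
    gcongr
    exact abs_sub _ _
  calc _ ≤ ∑ s, 1 / (M : ℝ) * (|rad (A s) s| + |rad (A' s) s|) := sum_le_sum fun s _ => hpt s
    _ = 1 / (M : ℝ) * (∑ s, |rad (A s) s| + ∑ s, |rad (A' s) s|) := by
        rw [← mul_sum, sum_add_distrib]
    _ ≤ 1 / (M : ℝ) * (2 ^ M * (16 * Real.sqrt ((max (vcDim H).toNat 1 : ℕ) * M)) +
          2 ^ M * (16 * Real.sqrt ((max (vcDim H).toNat 1 : ℕ) * M))) := by
        gcongr
    _ = _ := by ring

end Symmetrization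

/-! ### Uniform convergence for VC classes -/

section UniformConvergence

variable {X : Type*} [MeasurableSpace X] (μ : Measure X) [IsProbabilityMeasure μ]

lemma measurePreserving_reindex {ι κ : Type*} [Fintype ι] [Fintype κ] (e : ι ≃ κ) :
    MeasurePreserving (fun (x : κ → X) (i : ι) => x (e i)) (Measure.pi fun _ => μ)
      (Measure.pi fun _ => μ) := by
  have := measurePreserving_piCongrLeft (fun _ : ι => μ) e.symm
  convert! this using 1
  ext x i
  conv_rhs => rw [← e.symm_apply_apply i]
  rw [MeasurableEquiv.coe_piCongrLeft, Equiv.piCongrLeft_apply_apply]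

/-- This makes the supremum over a possibly uncountable class measurable: the largest gap depends
only on which of the finitely many patterns are realised. -/
lemma nullMeasurableSet_patterns_eq {H : Set (X → Label)}
    (hpat : ∀ (n : ℕ) (b : Fin n → Label),
      NullMeasurableSet {p : Fin n → X | ∃ h ∈ H, ∀ i, h (p i) = b i} (Measure.pi fun _ => μ))
    {M : ℕ} (B : Set (Fin M ⊕ Fin M → Label)) :
    NullMeasurableSet {q : Fin M ⊕ Fin M → X | patterns H q = B} (Measure.pi fun _ => μ) := by
  have hb : ∀ b : Fin M ⊕ Fin M → Label,
      NullMeasurableSet {q : Fin M ⊕ Fin M → X | b ∈ patterns H q} (Measure.pi fun _ => μ) := by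
    intro b
    have := (hpat (M + M) fun i => b (finSumFinEquiv.symm i)).preimage
      (measurePreserving_reindex μ (finSumFinEquiv (m := M) (n := M)).symm).quasiMeasurePreserving
    convert! this using 1
    ext q
    simp only [patterns, Set.mem_ofPred_eq, Set.mem_preimage]
    refine exists_congr fun h => and_congr_right fun _ => ?_
    exact (finSumFinEquiv.symm.forall_congr_left (p := fun i => h (q (finSumFinEquiv.symm i))
      = b (finSumFinEquiv.symm i))).trans (by simp) |>.symm
  have heq : {q : Fin M ⊕ Fin M → X | patterns H q = B} =
      ⋂ b, {q | b ∈ patterns H q ↔ b ∈ B} := by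
    ext q; simp [Set.ext_iff]
  rw [heq]
  refine NullMeasurableSet.iInter fun b => ?_
  by_cases hB : b ∈ B
  · simpa [hB] using hb b
  · simp only [hB, iff_false]
    exact (hb b).compl

lemma aemeasurable_maxGap {H : Set (X → Label)}
    (hpat : ∀ (n : ℕ) (b : Fin n → Label),
      NullMeasurableSet {p : Fin n → X | ∃ h ∈ H, ∀ i, h (p i) = b i} (Measure.pi fun _ => μ))
    (M : ℕ) :
    AEMeasurable (fun q : Fin M ⊕ Fin M → X => maxGap (patterns H q))
      (Measure.pi fun _ => μ) := by
  refine NullMeasurable.aemeasurable fun s _ => ?_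
  have : (fun q : Fin M ⊕ Fin M → X => maxGap (patterns H q)) ⁻¹' s =
      ⋃ B ∈ {B : Set (Fin M ⊕ Fin M → Label) | maxGap B ∈ s}, {q | patterns H q = B} := by
    ext q; simp
  rw [this]
  exact NullMeasurableSet.biUnion (Set.to_countable _) fun B _ =>
    nullMeasurableSet_patterns_eq μ hpat B

lemma integrable_maxGap {H : Set (X → Label)} (hne : H.Nonempty)
    (hpat : ∀ (n : ℕ) (b : Fin n → Label),
      NullMeasurableSet {p : Fin n → X | ∃ h ∈ H, ∀ i, h (p i) = b i} (Measure.pi fun _ => μ))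
    (M : ℕ) :
    Integrable (fun q : Fin M ⊕ Fin M → X => maxGap (patterns H q)) (Measure.pi fun _ => μ) :=
  Integrable.of_mem_Icc 0 1 (aemeasurable_maxGap μ hpat M)
    (Filter.Eventually.of_forall fun q => maxGap_mem_Icc hne q)

/-- Exchanges preserve the product measure, so the integral equals its average over all exchanges,
where the pointwise bound applies. -/
lemma integral_maxGap_le {H : Set (X → Label)} (hne : H.Nonempty) (hH : vcDim H ≠ ⊤)
    (hpat : ∀ (n : ℕ) (b : Fin n → Label),
      NullMeasurableSet {p : Fin n → X | ∃ h ∈ H, ∀ i, h (p i) = b i} (Measure.pi fun _ => μ))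
    (M : ℕ) :
    ∫ q : Fin M ⊕ Fin M → X, maxGap (patterns H q) ∂(Measure.pi fun _ => μ)
      ≤ 32 * Real.sqrt ((max (vcDim H).toNat 1 : ℕ) * M) / M := by
  set I := ∫ q : Fin M ⊕ Fin M → X, maxGap (patterns H q) ∂(Measure.pi fun _ => μ)
  have hint := integrable_maxGap μ hne hpat M
  have hmp := fun s : Fin M → Bool => measurePreserving_reindex μ (swapHalves s)
  have hs : ∀ s : Fin M → Bool,
      ∫ q : Fin M ⊕ Fin M → X, maxGap (patterns H (q ∘ swapHalves s)) ∂(Measure.pi fun _ => μ)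
        = I := by
    intro s
    have h1 := integral_map (hmp s).measurable.aemeasurable
      (f := fun q : Fin M ⊕ Fin M → X => maxGap (patterns H q))
      (by rw [(hmp s).map_eq]; exact hint.aestronglyMeasurable)
    rw [(hmp s).map_eq] at h1
    exact h1.symm
  have hints : ∀ s : Fin M → Bool,
      Integrable (fun q : Fin M ⊕ Fin M → X => maxGap (patterns H (q ∘ swapHalves s)))
        (Measure.pi fun _ => μ) := fun s => (hmp s).integrable_comp_of_integrable hint
  have h2 : ∑ _s : Fin M → Bool, I
      ≤ 2 ^ M * (32 * Real.sqrt ((max (vcDim H).toNat 1 : ℕ) * M) / M) := by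
    rw [← Finset.sum_congr rfl fun s _ => hs s, ← integral_finsetSum _ fun s _ => hints s]
    calc _ ≤ ∫ q : Fin M ⊕ Fin M → X,
          2 ^ M * (32 * Real.sqrt ((max (vcDim H).toNat 1 : ℕ) * M) / M)
            ∂(Measure.pi fun _ => μ) :=
          integral_mono (integrable_finsetSum _ fun s _ => hints s) (integrable_const _)
            fun q => sum_maxGap_swap_le hne hH q
      _ = _ := by simp
  rw [Finset.sum_const, nsmul_eq_mul, Finset.card_univ] at h2
  have h3 : (Fintype.card (Fin M → Bool) : ℝ) = 2 ^ M := by simp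
  rw [h3] at h2
  exact le_of_mul_le_mul_left h2 (by positivity)

/-- If a member of the class has a large deviation on the first half of a double sample, then its
expected gap over the second half is large. -/
lemma abs_sub_le_integral_gap {h : X → Label} (hm : NullMeasurableSet {x | h x = 1} μ) {M : ℕ}
    (hM : 0 < M) (p : Fin M → X) :
    |μ.real {x | h x = 1} - 1 / (M : ℝ) * ∑ i, (if h (p i) = 1 then (1 : ℝ) else 0)|
      ≤ ∫ p' : Fin M → X, |gap fun k : Fin M ⊕ Fin M => h (Sum.elim p p' k)|
          ∂(Measure.pi fun _ => μ) := by
  have hM' : (M : ℝ) ≠ 0 := by exact_mod_cast hM.ne'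
  have hcomp : ∀ i : Fin M, (fun p' : Fin M → X => if h (p' i) = 1 then (1 : ℝ) else 0)
      = ((fun p' : Fin M → X => p' i) ⁻¹' {x | h x = 1}).indicator 1 := by
    intro i; ext p'; simp [Set.indicator_apply]
  have hnm : ∀ i : Fin M, NullMeasurableSet ((fun p' : Fin M → X => p' i) ⁻¹' {x | h x = 1})
      (Measure.pi fun _ => μ) := fun i =>
    hm.preimage (measurePreserving_eval (fun _ : Fin M => μ) i).quasiMeasurePreserving
  have hint : ∀ i : Fin M, Integrable (fun p' : Fin M → X => if h (p' i) = 1 then (1 : ℝ) else 0)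
      (Measure.pi fun _ => μ) := by
    intro i
    rw [hcomp i]
    exact (integrable_const (1 : ℝ)).indicator₀ (hnm i)
  have hval : ∀ i : Fin M, ∫ p' : Fin M → X, (if h (p' i) = 1 then (1 : ℝ) else 0)
      ∂(Measure.pi fun _ => μ) = μ.real {x | h x = 1} := by
    intro i
    rw [hcomp i, integral_indicator₀ (hnm i)]
    simp only [Pi.one_apply, integral_const, smul_eq_mul, mul_one, measureReal_def,
      Measure.restrict_apply_univ]
    rw [(measurePreserving_eval (fun _ : Fin M => μ) i).measure_preimage hm]
  have hgap : ∀ p' : Fin M → X, gap (fun k : Fin M ⊕ Fin M => h (Sum.elim p p' k))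
      = 1 / (M : ℝ) * ∑ i, (if h (p i) = 1 then (1 : ℝ) else 0)
        - 1 / (M : ℝ) * ∑ i, (if h (p' i) = 1 then (1 : ℝ) else 0) := by
    intro p'
    simp only [gap, Sum.elim_inl, Sum.elim_inr, Finset.sum_sub_distrib, mul_sub]
    rfl
  -- With `p` fixed, the gap averages to the deviation on `p` up to sign; the claim is then `|∫ f| ≤
  -- ∫ |f|`.
  have hI : ∫ p' : Fin M → X, gap (fun k : Fin M ⊕ Fin M => h (Sum.elim p p' k))
      ∂(Measure.pi fun _ => μ)
      = 1 / (M : ℝ) * ∑ i, (if h (p i) = 1 then (1 : ℝ) else 0) - μ.real {x | h x = 1} := by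
    simp_rw [hgap]
    rw [integral_sub (integrable_const _) ((integrable_finsetSum _ fun i _ => hint i).const_mul _),
      integral_const, integral_const_mul, integral_finsetSum _ fun i _ => hint i]
    simp_rw [hval]
    rw [Finset.sum_const]
    simp [hM']
  rw [abs_sub_comm, ← hI]
  exact abs_integral_le_integral_abs

/-- The uniform law of large numbers for VC classes, with the optimal rate. -/
theorem exists_approx_sample {H : Set (X → Label)} (hne : H.Nonempty) (hH : vcDim H ≠ ⊤)
    (hmeas : ∀ h ∈ H, NullMeasurableSet {x | h x = 1} μ)
    (hpat : ∀ (n : ℕ) (b : Fin n → Label),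
      NullMeasurableSet {p : Fin n → X | ∃ h ∈ H, ∀ i, h (p i) = b i} (Measure.pi fun _ => μ))
    {M : ℕ} (hM : 0 < M) {ε : ℝ}
    (hε : 32 * Real.sqrt ((max (vcDim H).toNat 1 : ℕ) * M) / M < ε) :
    ∃ p : Fin M → X, ∀ h ∈ H,
      |μ.real {x | h x = 1} - 1 / (M : ℝ) * ∑ i, (if h (p i) = 1 then (1 : ℝ) else 0)| ≤ ε := by
  by_contra! hcon
  have hmp := measurePreserving_sumPiEquivProdPi_symm (X := fun _ : Fin M ⊕ Fin M => X)
    (fun _ => μ)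
  have hint := integrable_maxGap μ hne hpat M
  have hint' : Integrable (fun z => maxGap (patterns H
      ((MeasurableEquiv.sumPiEquivProdPi fun _ : Fin M ⊕ Fin M => X).symm z)))
      ((Measure.pi fun _ => μ).prod (Measure.pi fun _ => μ)) :=
    hmp.integrable_comp_of_integrable hint
  have hle := integral_maxGap_le μ hne hH hpat M
  rw [← hmp.integral_comp', integral_prod _ hint'] at hle
  have hlow : ε ≤ ∫ p : Fin M → X, ∫ p' : Fin M → X,
      maxGap (patterns H ((MeasurableEquiv.sumPiEquivProdPi fun _ : Fin M ⊕ Fin M => X).symm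
        (p, p'))) ∂(Measure.pi fun _ => μ) ∂(Measure.pi fun _ => μ) := by
    calc ε = ∫ _p : Fin M → X, ε ∂(Measure.pi fun _ => μ) := by simp
      _ ≤ _ := by
        refine integral_mono_ae (integrable_const _) hint'.integral_prod_left ?_
        filter_upwards [hint'.prod_right_ae] with p hp
        -- The bad hypothesis depends on `p` only and is bounded by the largest gap at once, so no
        -- measurable selection is needed.
        obtain ⟨h, hh, hbad⟩ := hcon p
        refine hbad.le.trans ((abs_sub_le_integral_gap μ (hmeas h hh) hM p).trans ?_)
        refine integral_mono_of_nonneg (Filter.Eventually.of_forall fun _ => abs_nonneg _) hp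
          (Filter.Eventually.of_forall fun p' => ?_)
        refine abs_gap_le_maxGap ⟨h, hh, fun k => ?_⟩
        rcases k with i | i <;> rfl
  exact absurd (hlow.trans hle) (not_le.2 hε)

end UniformConvergence

/-! ### Transfer of null-measurability from Lebesgue to Gaussian measure -/

section AbsolutelyContinuous

lemma pi_absolutelyContinuous {X : Type*} [MeasurableSpace X] {μ ν : Measure X} [SigmaFinite μ]
    [SigmaFinite ν] (h : μ ≪ ν) (n : ℕ) :
    (Measure.pi fun _ : Fin n => μ) ≪ Measure.pi fun _ : Fin n => ν := by
  induction n with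
  | zero => rw [Measure.pi_of_empty, Measure.pi_of_empty]
  | succ n ih =>
    have h1 := (measurePreserving_piFinSuccAbove (fun _ : Fin (n + 1) => μ) 0).symm
    have h2 := (measurePreserving_piFinSuccAbove (fun _ : Fin (n + 1) => ν) 0).symm
    rw [← h1.map_eq, ← h2.map_eq]
    exact (h.prod ih).map h1.measurable

lemma stdGaussian_absolutelyContinuous (d : ℕ) : stdGaussian (Euc d) ≪ volume := by
  rw [← map_pi_eq_stdGaussian, ← (PiLp.volume_preserving_toLp (Fin d)).map_eq]
  exact (pi_absolutelyContinuous (gaussianReal_absolutelyContinuous 0 one_ne_zero) d).map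
    (PiLp.volume_preserving_toLp (Fin d)).measurable

/-- The affine map `u ↦ a + σ u`. -/
noncomputable def affineHomeo {d : ℕ} (a : Euc d) {σ : ℝ} (hσ : σ ≠ 0) : Euc d ≃ₜ Euc d :=
  (Homeomorph.smulOfNeZero σ hσ).trans (Homeomorph.addLeft a)

lemma quasiMeasurePreserving_affine {d : ℕ} (a : Euc d) {σ : ℝ} (hσ : σ ≠ 0) :
    Measure.QuasiMeasurePreserving (fun u : Euc d => a + σ • u) volume volume := by
  refine ⟨by fun_prop, Measure.AbsolutelyContinuous.mk fun s hs h0 => ?_⟩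
  rw [Measure.map_apply (by fun_prop) hs]
  have : (fun u : Euc d => a + σ • u) ⁻¹' s = (σ • ·) ⁻¹' ((a + ·) ⁻¹' s) := rfl
  rw [this, Measure.addHaar_preimage_smul _ hσ, measure_preimage_add, h0, mul_zero]

end AbsolutelyContinuous

/-! ### Shifted Gaussians and the smoothing estimate -/

section Shift

variable {d : ℕ}

lemma map_inner_stdGaussian (w : Euc d) :
    (stdGaussian (Euc d)).map (fun x => inner ℝ w x) = gaussianReal 0 (‖w‖ ^ 2).toNNReal := by
  have h := IsGaussian.map_eq_gaussianReal (μ := (stdGaussian (Euc d))) (innerSL ℝ w)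
  rw [integral_strongDual_stdGaussian, variance_dual_stdGaussian, innerSL_apply_norm] at h
  exact h

lemma integrable_exp_inner (w : Euc d) (t : ℝ) :
    Integrable (fun x => Real.exp (t * inner ℝ w x)) (stdGaussian (Euc d)) := by
  have h := integrable_exp_mul_gaussianReal (μ := 0) (v := (‖w‖ ^ 2).toNNReal) t
  rw [← map_inner_stdGaussian w] at h
  exact (integrable_map_measure (g := fun x => Real.exp (t * x)) (by fun_prop)
    (by fun_prop)).1 h

lemma integral_exp_inner (w : Euc d) (t : ℝ) :
    ∫ x, Real.exp (t * inner ℝ w x) ∂(stdGaussian (Euc d)) = Real.exp (‖w‖ ^ 2 * t ^ 2 / 2) := by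
  have h := mgf_gaussianReal (map_inner_stdGaussian w) t
  rw [mgf, zero_mul, zero_add, Real.coe_toNNReal _ (by positivity)] at h
  exact h

/-- The density of the standard Gaussian shifted by `w`. -/
noncomputable def shiftDensity (w x : Euc d) : ℝ := Real.exp (inner ℝ w x - ‖w‖ ^ 2 / 2)

lemma measurable_shiftDensity (w : Euc d) : Measurable (shiftDensity w) := by
  unfold shiftDensity; fun_prop

lemma shiftDensity_eq (w x : Euc d) :
    shiftDensity w x = Real.exp (-(‖w‖ ^ 2 / 2)) * Real.exp (1 * inner ℝ w x) := by
  rw [shiftDensity, ← Real.exp_add]; ring_nf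

lemma shiftDensity_sq (w x : Euc d) :
    shiftDensity w x ^ 2 = Real.exp (-‖w‖ ^ 2) * Real.exp (2 * inner ℝ w x) := by
  rw [shiftDensity, ← Real.exp_nat_mul, ← Real.exp_add]; push_cast; ring_nf

lemma integrable_shiftDensity (w : Euc d) : Integrable (shiftDensity w) (stdGaussian (Euc d)) := by
  have := (integrable_exp_inner w 1).const_mul (Real.exp (-(‖w‖ ^ 2 / 2)))
  exact this.congr (Filter.Eventually.of_forall fun x => (shiftDensity_eq w x).symm)

lemma integral_shiftDensity (w : Euc d) : ∫ x, shiftDensity w x ∂(stdGaussian (Euc d)) = 1 := by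
  simp_rw [shiftDensity_eq]
  rw [integral_const_mul, integral_exp_inner, ← Real.exp_add]
  simp

lemma integrable_shiftDensity_sq (w : Euc d) :
    Integrable (fun x => shiftDensity w x ^ 2) (stdGaussian (Euc d)) := by
  have := (integrable_exp_inner w 2).const_mul (Real.exp (-‖w‖ ^ 2))
  exact this.congr (Filter.Eventually.of_forall fun x => (shiftDensity_sq w x).symm)

lemma integral_shiftDensity_sq (w : Euc d) :
    ∫ x, shiftDensity w x ^ 2 ∂(stdGaussian (Euc d)) = Real.exp (‖w‖ ^ 2) := by
  simp_rw [shiftDensity_sq]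
  rw [integral_const_mul, integral_exp_inner, ← Real.exp_add]
  ring_nf

/-- Exponential tilt and characteristic function together, computed coordinatewise; the cases `w`
and `0` give the two sides compared in `map_add_stdGaussian`. -/
lemma integral_cexp_inner (w t : Euc d) :
    ∫ x, Complex.exp ((inner ℝ w x : ℝ) + (inner ℝ x t : ℝ) * Complex.I) ∂(stdGaussian (Euc d))
      = Complex.exp ((‖w‖ ^ 2 / 2 : ℝ) + (inner ℝ w t : ℝ) * Complex.I - (‖t‖ ^ 2 / 2 : ℝ)) := by
  rw [← map_pi_eq_stdGaussian, integral_map (by fun_prop) (by fun_prop)]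
  have h1 : ∀ x : Fin d → ℝ, Complex.exp ((inner ℝ w (WithLp.toLp 2 x) : ℝ)
      + (inner ℝ (WithLp.toLp 2 x) t : ℝ) * Complex.I)
      = ∏ i, Complex.exp (((w i : ℂ) + t i * Complex.I) * x i) := by
    intro x
    rw [← Complex.exp_sum]
    congr 1
    simp only [PiLp.inner_apply, RCLike.inner_apply, conj_trivial, Complex.ofReal_sum,
      Complex.ofReal_mul, Finset.sum_mul]
    rw [← Finset.sum_add_distrib]
    exact Finset.sum_congr rfl fun i _ => by ring
  simp_rw [h1]
  rw [integral_fintype_prod_eq_prod (𝕜 := ℂ) (f := fun (i : Fin d) (x : ℝ) =>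
    Complex.exp (((w i : ℂ) + t i * Complex.I) * x))]
  have h2 : ∀ z : ℂ, ∫ x : ℝ, Complex.exp (z * x) ∂(gaussianReal 0 1)
      = Complex.exp (z ^ 2 / 2) := by
    intro z
    have := complexMGF_id_gaussianReal (μ := 0) (v := 1) z
    simpa [complexMGF] using this
  simp_rw [h2]
  rw [← Complex.exp_sum]
  congr 1
  rw [EuclideanSpace.real_norm_sq_eq, EuclideanSpace.real_norm_sq_eq]
  simp only [PiLp.inner_apply, RCLike.inner_apply, conj_trivial, Complex.ofReal_sum,
      Complex.ofReal_mul, Finset.sum_mul, Complex.ofReal_div, Complex.ofReal_pow, Finset.sum_div]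
  rw [← Finset.sum_add_distrib, ← Finset.sum_sub_distrib]
  refine Finset.sum_congr rfl fun i _ => ?_
  push_cast
  linear_combination ((t i : ℂ) ^ 2 / 2) * Complex.I_sq

/-- The Cameron–Martin formula: both finite measures have the same characteristic function. -/
lemma map_add_stdGaussian (w : Euc d) :
    (stdGaussian (Euc d)).map (fun x => w + x) =
      (stdGaussian (Euc d)).withDensity fun x => ENNReal.ofReal (shiftDensity w x) := by
  have hfin : IsFiniteMeasure
      ((stdGaussian (Euc d)).withDensity fun x => ENNReal.ofReal (shiftDensity w x)) :=
    isFiniteMeasure_withDensity_ofReal (integrable_shiftDensity w).2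
  have : IsProbabilityMeasure ((stdGaussian (Euc d)).map fun x => w + x) :=
    Measure.isProbabilityMeasure_map (by fun_prop)
  apply Measure.ext_of_charFun
  ext t
  rw [charFun_apply, charFun_apply, integral_map (by fun_prop) (by fun_prop),
    integral_withDensity_eq_integral_toReal_smul
      (measurable_shiftDensity w).ennreal_ofReal (by simp)]
  have h1 : ∀ x : Euc d, (ENNReal.ofReal (shiftDensity w x)).toReal •
      Complex.exp ((inner ℝ x t : ℝ) * Complex.I) = Complex.exp (-(‖w‖ ^ 2 / 2 : ℝ)) *
        Complex.exp ((inner ℝ w x : ℝ) + (inner ℝ x t : ℝ) * Complex.I) := by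
    intro x
    rw [shiftDensity, ENNReal.toReal_ofReal (Real.exp_pos _).le, Complex.real_smul,
      Complex.ofReal_exp, ← Complex.exp_add, ← Complex.exp_add]
    push_cast; ring_nf
  have h2 : ∀ x : Euc d, Complex.exp ((inner ℝ (w + x) t : ℝ) * Complex.I)
      = Complex.exp ((inner ℝ w t : ℝ) * Complex.I) *
        Complex.exp ((inner ℝ (0 : Euc d) x : ℝ) + (inner ℝ x t : ℝ) * Complex.I) := by
    intro x
    rw [inner_add_left, inner_zero_left, ← Complex.exp_add]; push_cast; ring_nf
  simp_rw [h1, h2]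
  rw [integral_const_mul, integral_const_mul, integral_cexp_inner, integral_cexp_inner,
    ← Complex.exp_add, ← Complex.exp_add]
  congr 1
  simp
  ring

/-- Gaussian smoothing makes bounded functions Lipschitz. -/
lemma abs_integral_shift_sub_le {f : Euc d → ℝ} (hf : AEMeasurable f volume)
    (hb : ∀ x, |f x| ≤ 1) {w : Euc d} {c : ℝ} (hw : ‖w‖ ≤ c) (hc : 0 < c) (hc1 : c ≤ 1) :
    |∫ x, f (w + x) ∂(stdGaussian (Euc d)) - ∫ x, f x ∂(stdGaussian (Euc d))| ≤ 3 / 2 * c := by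
  have hac := stdGaussian_absolutelyContinuous d
  have hfg : AEStronglyMeasurable f (stdGaussian (Euc d)) := (hf.mono_ac hac).aestronglyMeasurable
  have hL := integrable_shiftDensity w
  have hf1 : Integrable f (stdGaussian (Euc d)) :=
    Integrable.of_bound hfg 1 (Filter.Eventually.of_forall hb)
  have hLf : Integrable (fun x => shiftDensity w x * f x) (stdGaussian (Euc d)) :=
    hL.mul_bdd hfg (Filter.Eventually.of_forall hb)
  have h1 : ∫ x, f (w + x) ∂(stdGaussian (Euc d))
      = ∫ x, shiftDensity w x * f x ∂(stdGaussian (Euc d)) := by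
    have hmap := map_add_stdGaussian w
    have hac' : (stdGaussian (Euc d)).map (fun x => w + x) ≪ volume := by
      rw [hmap]; exact (withDensity_absolutelyContinuous _ _).trans hac
    rw [← integral_map (φ := fun x => w + x) (by fun_prop)
      (hf.mono_ac hac').aestronglyMeasurable, hmap,
      integral_withDensity_eq_integral_toReal_smul
        (measurable_shiftDensity w).ennreal_ofReal (by simp)]
    refine integral_congr_ae (Filter.Eventually.of_forall fun x => ?_)
    simp [ENNReal.toReal_ofReal (Real.exp_pos _).le, shiftDensity]
  rw [h1, ← integral_sub hLf hf1]
  have hint' : Integrable (fun x => shiftDensity w x ^ 2 - 2 * shiftDensity w x)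
      (stdGaussian (Euc d)) :=
    (integrable_shiftDensity_sq w).sub (hL.const_mul 2)
  have hint : Integrable (fun x => shiftDensity w x ^ 2 - 2 * shiftDensity w x + 1)
      (stdGaussian (Euc d)) :=
    hint'.add (integrable_const _)
  have hval : ∫ x, (shiftDensity w x ^ 2 - 2 * shiftDensity w x + 1) ∂(stdGaussian (Euc d))
      = Real.exp (‖w‖ ^ 2) - 1 := by
    rw [integral_add hint' (integrable_const _),
      integral_sub (integrable_shiftDensity_sq w) (hL.const_mul 2), integral_const_mul,
      integral_shiftDensity_sq, integral_shiftDensity]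
    simp; ring
  -- The inequality `u ≤ u² / (2 c) + c / 2` serves as Cauchy–Schwarz. As `∫ (L - 1)² = exp ‖w‖² - 1
  -- ≤ 2 c²` for `c ≤ 1`, the total is `c + c / 2`.
  have hpt : ∀ x, |shiftDensity w x * f x - f x|
      ≤ (1 / (2 * c)) * (shiftDensity w x ^ 2 - 2 * shiftDensity w x + 1) + c / 2 := by
    intro x
    rw [← sub_one_mul, abs_mul]
    have h2 := mul_le_mul_of_nonneg_left (hb x) (abs_nonneg (shiftDensity w x - 1))
    rw [mul_one] at h2
    refine h2.trans ?_
    have h3 : shiftDensity w x ^ 2 - 2 * shiftDensity w x + 1 = |shiftDensity w x - 1| ^ 2 := by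
      rw [sq_abs]; ring
    rw [h3]
    have h4 : (1 / (2 * c)) * |shiftDensity w x - 1| ^ 2 + c / 2 - |shiftDensity w x - 1|
        = (|shiftDensity w x - 1| - c) ^ 2 / (2 * c) := by field_simp; ring
    have h5 : 0 ≤ (|shiftDensity w x - 1| - c) ^ 2 / (2 * c) := by positivity
    linarith
  have hexp : Real.exp (‖w‖ ^ 2) - 1 ≤ 2 * c ^ 2 := by
    have hw2 : ‖w‖ ^ 2 ≤ c ^ 2 := pow_le_pow_left₀ (norm_nonneg _) hw 2
    have hw1 : ‖w‖ ^ 2 ≤ 1 := hw2.trans (pow_le_one₀ hc.le hc1)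
    have := Real.abs_exp_sub_one_le (x := ‖w‖ ^ 2) (by rwa [abs_of_nonneg (by positivity)])
    rw [abs_of_nonneg (by positivity : 0 ≤ ‖w‖ ^ 2)] at this
    linarith [le_abs_self (Real.exp (‖w‖ ^ 2) - 1)]
  calc |∫ x, (shiftDensity w x * f x - f x) ∂(stdGaussian (Euc d))|
      ≤ ∫ x, |shiftDensity w x * f x - f x| ∂(stdGaussian (Euc d)) :=
        abs_integral_le_integral_abs
    _ ≤ ∫ x, ((1 / (2 * c)) * (shiftDensity w x ^ 2 - 2 * shiftDensity w x + 1) + c / 2)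
          ∂(stdGaussian (Euc d)) :=
        integral_mono (hLf.sub hf1).abs ((hint.const_mul _).add (integrable_const _)) hpt
    _ = (1 / (2 * c)) * (Real.exp (‖w‖ ^ 2) - 1) + c / 2 := by
        rw [integral_add (hint.const_mul _) (integrable_const _), integral_const_mul, hval]
        simp
    _ ≤ (1 / (2 * c)) * (2 * c ^ 2) + c / 2 := by gcongr
    _ = 3 / 2 * c := by field_simp; ring

end Shift

/-! ### Existence of the noise points -/

section Approximation

variable {d : ℕ}

/-- Passing to the complement only flips the sign of the deviation, so label `1` suffices. -/
lemma abs_sub_le_of_label_one {μ : Measure (Euc d)} [IsProbabilityMeasure μ]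
    {h : Euc d → Label} (hm : NullMeasurableSet {u | h u = 1} μ) {M : ℕ} (hM : 0 < M)
    (p : Fin M → Euc d) (y : Label) :
    |μ.real {u | h u = y} - 1 / (M : ℝ) * ∑ i, (if h (p i) = y then (1 : ℝ) else 0)|
      = |μ.real {u | h u = 1} - 1 / (M : ℝ) * ∑ i, (if h (p i) = 1 then (1 : ℝ) else 0)| := by
  rcases Int.units_eq_one_or y with rfl | rfl
  · rfl
  have h1 : {u | h u = -1} = {u | h u = 1}ᶜ := by
    ext u; exact (label_ne_one_iff (h u)).symm
  have h2 : ∑ i, (if h (p i) = -1 then (1 : ℝ) else 0)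
      = M - ∑ i, (if h (p i) = 1 then (1 : ℝ) else 0) := by
    rw [eq_sub_iff_add_eq, ← Finset.sum_add_distrib]
    calc _ = ∑ i : Fin M, (1 : ℝ) := by
          refine Finset.sum_congr rfl fun i _ => ?_
          by_cases hh : h (p i) = 1
          · simp [hh]
          · simp [(label_ne_one_iff _).1 hh]
      _ = M := by simp
  have hM' : (M : ℝ) ≠ 0 := by exact_mod_cast hM.ne'
  rw [h1, measureReal_compl₀ hm, probReal_univ, h2, mul_sub, one_div_mul_cancel hM',
    ← abs_neg]
  congr 1; ring

/-- Points as in `IsGaussApprox` exist. -/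
theorem exists_isGaussApprox {H : Set (Euc d → Label)} (hne : H.Nonempty) (hm : MeasurableClass H)
    (hH : vcDim H ≠ ⊤) {σ ε : ℝ} (hσ : 0 < σ) (hε : 0 < ε) (Z : Finset (Euc d)) :
    ∃ (M : ℕ) (z : Z → Fin M → Euc d), IsGaussApprox H σ ε 2000 Z M z := by
  set v := max (vcDim H).toNat 1 with hv
  have hv1 : (1 : ℝ) ≤ v := by exact_mod_cast le_max_right _ 1
  -- The rate `32 √(v / M) < ε / 4` needs `M > 1024 v / (ε / 4)²`.
  set M := ⌈2000 * (v : ℕ) / (ε / 4) ^ 2⌉₊ with hMdef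
  have hM : 0 < M := Nat.ceil_pos.2 (by positivity)
  have hM' : (0 : ℝ) < M := by exact_mod_cast hM
  have hMle : 2000 * v / (ε / 4) ^ 2 ≤ M := Nat.le_ceil _
  have hrate : 32 * Real.sqrt (v * M) / M < ε / 4 := by
    rw [div_lt_iff₀ hM', ← lt_div_iff₀' (by norm_num), Real.sqrt_lt' (by positivity), div_pow,
      lt_div_iff₀ (by norm_num), mul_pow]
    rw [div_le_iff₀ (by positivity)] at hMle
    nlinarith
  have hx : ∀ x' : Euc d, ∃ z : Fin M → Euc d, ∀ y : Label, ∀ h ∈ H,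
      |(stdGaussian (Euc d)).real {u | h (x' + σ • u) = y}
        - 1 / (M : ℝ) * ∑ i, (if h (x' + σ • z i) = y then (1 : ℝ) else 0)| ≤ ε / 4 := by
    intro x'
    -- Sampling is from the law of `x' + σ u`, so that the class itself is used; the sample is then
    -- pulled back to noise points.
    set e := (affineHomeo x' hσ.ne').toMeasurableEquiv
    set μ := (stdGaussian (Euc d)).map e
    have : IsProbabilityMeasure μ := Measure.isProbabilityMeasure_map e.measurable.aemeasurable
    have hac : μ ≪ volume := ((stdGaussian_absolutelyContinuous d).map e.measurable).trans
      (quasiMeasurePreserving_affine x' hσ.ne').absolutelyContinuous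
    have hmeas : ∀ h ∈ H, NullMeasurableSet {x | h x = 1} μ := fun h hh => (hm.1 h hh).mono_ac hac
    obtain ⟨p, hp⟩ := exists_approx_sample μ hne hH hmeas
      (fun n b => (hm.2 n b).mono_ac (pi_absolutelyContinuous hac n)) hM hrate
    refine ⟨fun i => e.symm (p i), fun y h hh => ?_⟩
    have h1 : ∀ i, x' + σ • e.symm (p i) = p i := fun i => e.apply_symm_apply (p i)
    have h2 : (stdGaussian (Euc d)).real {u | h (x' + σ • u) = y} = μ.real {u | h u = y} := by
      rw [measureReal_def, measureReal_def, e.map_apply]; rfl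
    simp_rw [h1]
    rw [h2, abs_sub_le_of_label_one (hmeas h hh) hM]
    exact hp h hh
  choose z hz using hx
  exact ⟨M, fun x' => z x', hM, le_rfl, fun x' y h hh => hz x' y h hh⟩

end Approximation

/-! ### Regret of Multiplicative Weights -/

section MultiplicativeWeights

/-- Hoeffding's lemma for a Bernoulli variable. -/
lemma hoeffding_bernoulli {m : ℝ} (h0 : 0 ≤ m) (h1 : m ≤ 1) (η : ℝ) :
    1 - m + m * Real.exp (-η) ≤ Real.exp (-η * m + η ^ 2 / 8) := by
  -- The Bernoulli law of mean `m`; Hoeffding's lemma on `[0, 1]` has variance proxy `1 / 4`.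
  set μ : Measure ℝ := ENNReal.ofReal (1 - m) • Measure.dirac 0 +
    ENNReal.ofReal m • Measure.dirac 1 with hμ
  have hint : ∀ f : ℝ → ℝ, ∫ x, f x ∂μ = (1 - m) * f 0 + m * f 1 := by
    intro f
    rw [hμ, integral_add_measure ((integrable_dirac (by simp)).smul_measure (by simp))
      ((integrable_dirac (by simp)).smul_measure (by simp)), integral_smul_measure,
      integral_smul_measure, integral_dirac, integral_dirac,
      ENNReal.toReal_ofReal (by linarith), ENNReal.toReal_ofReal h0, smul_eq_mul, smul_eq_mul]
  have : IsProbabilityMeasure μ := ⟨by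
    simp only [hμ, Measure.add_apply, Measure.smul_apply, measure_univ, smul_eq_mul, mul_one]
    rw [← ENNReal.ofReal_add (by linarith) h0]; simp⟩
  have hae : ∀ᵐ x ∂μ, id x ∈ Set.Icc (0 : ℝ) 1 := by
    rw [hμ, ae_add_measure_iff]
    exact ⟨Measure.ae_smul_measure (by simp) _, Measure.ae_smul_measure (by simp) _⟩
  have h := (hasSubgaussianMGF_of_mem_Icc (X := id) (μ := μ) aemeasurable_id hae).mgf_le (-η)
  rw [mgf, hint, hint] at h
  simp only [id, mul_zero, zero_add, mul_one, zero_sub, sub_zero, nnnorm_one] at h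
  have h2 : ((((1 : NNReal) / 2) ^ 2 : NNReal) : ℝ) * (-η) ^ 2 / 2 = η ^ 2 / 8 := by
    push_cast; ring
  rw [h2] at h
  rw [Real.exp_add]
  calc 1 - m + m * Real.exp (-η)
      = Real.exp (-η * m) * ((1 - m) * Real.exp (-η * -m) + m * Real.exp (-η * (1 - m))) := by
        rw [mul_add, mul_left_comm, mul_left_comm _ m, ← Real.exp_add, ← Real.exp_add]
        ring_nf; simp; ring
    _ ≤ _ := by gcongr

variable {ι : Type*} {F : Finset ι} {η : ℝ} {ℓ : ℕ → ι → ℝ}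

lemma mwProb_pos (hF : F.Nonempty) (t : ℕ) (f : ι) : 0 < mwProb F η ℓ t f := by
  induction t generalizing f with
  | zero => have := hF.card_pos; simp only [mwProb]; positivity
  | succ t ih =>
    simp only [mwProb]
    exact div_pos (mul_pos (ih f) (Real.exp_pos _))
      (Finset.sum_pos (fun g _ => mul_pos (ih g) (Real.exp_pos _)) hF)

lemma sum_mwProb (hF : F.Nonempty) (t : ℕ) : ∑ f ∈ F, mwProb F η ℓ t f = 1 := by
  cases t with
  | zero =>
    have : (F.card : ℝ) ≠ 0 := by exact_mod_cast hF.card_pos.ne'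
    simp [mwProb, this]
  | succ t =>
    simp only [mwProb]
    rw [← Finset.sum_div, div_self]
    exact (Finset.sum_pos (fun g _ => mul_pos (mwProb_pos hF t g) (Real.exp_pos _)) hF).ne'

/-- For losses in `{0, 1}` the normalizer is the Laplace transform of a Bernoulli variable whose
mean is the expected loss. -/
lemma log_normalizer_le (hF : F.Nonempty) (hℓ : ∀ t f, ℓ t f = 0 ∨ ℓ t f = 1) (t : ℕ) :
    Real.log (∑ f ∈ F, mwProb F η ℓ t f * Real.exp (-η * ℓ t f))
      ≤ -η * (∑ f ∈ F, mwProb F η ℓ t f * ℓ t f) + η ^ 2 / 8 := by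
  set m := ∑ f ∈ F, mwProb F η ℓ t f * ℓ t f with hm
  have h0 : 0 ≤ m := Finset.sum_nonneg fun f _ => mul_nonneg (mwProb_pos hF t f).le (by
    rcases hℓ t f with h | h <;> simp [h])
  have h1 : m ≤ 1 := by
    rw [← sum_mwProb (η := η) (ℓ := ℓ) hF t]
    refine Finset.sum_le_sum fun f _ => ?_
    have := mwProb_pos (η := η) (ℓ := ℓ) hF t f
    rcases hℓ t f with h | h <;> simp [h, this.le]
  have h2 : ∑ f ∈ F, mwProb F η ℓ t f * Real.exp (-η * ℓ t f) = 1 - m + m * Real.exp (-η) := by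
    rw [hm, ← sum_mwProb (η := η) (ℓ := ℓ) hF t, Finset.sum_mul, ← Finset.sum_sub_distrib,
      ← Finset.sum_add_distrib]
    refine Finset.sum_congr rfl fun f _ => ?_
    rcases hℓ t f with h | h <;> simp [h]
  rw [← Real.log_exp (-η * m + η ^ 2 / 8)]
  refine Real.log_le_log ?_ (h2 ▸ hoeffding_bernoulli h0 h1 η)
  exact Finset.sum_pos (fun g _ => mul_pos (mwProb_pos hF t g) (Real.exp_pos _)) hF

/-- The potential argument: the updates telescope in logarithms, and a probability has nonpositive
logarithm. -/
lemma log_mwProb (hF : F.Nonempty) (f : ι) (T : ℕ) :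
    Real.log (mwProb F η ℓ T f) = -Real.log F.card - η * ∑ t ∈ Finset.range T, ℓ t f
      - ∑ t ∈ Finset.range T, Real.log (∑ f ∈ F, mwProb F η ℓ t f * Real.exp (-η * ℓ t f)) := by
  induction T with
  | zero => simp [mwProb]
  | succ T ih =>
    have hp := mwProb_pos (η := η) (ℓ := ℓ) hF T f
    have hZ : 0 < ∑ f ∈ F, mwProb F η ℓ T f * Real.exp (-η * ℓ T f) :=
      Finset.sum_pos (fun g _ => mul_pos (mwProb_pos hF T g) (Real.exp_pos _)) hF
    rw [mwProb, Real.log_div (by positivity) hZ.ne', Real.log_mul hp.ne' (by positivity),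
      Real.log_exp, ih, Finset.sum_range_succ, Finset.sum_range_succ]
    ring

/-- The regret bound of Multiplicative Weights for a general learning rate. -/
lemma mw_regret_rate (hF : F.Nonempty) (hℓ : ∀ t f, ℓ t f = 0 ∨ ℓ t f = 1) {f₀ : ι} (hf₀ : f₀ ∈ F)
    (T : ℕ) :
    η * (∑ t ∈ Finset.range T, ∑ f ∈ F, mwProb F η ℓ t f * ℓ t f
        - ∑ t ∈ Finset.range T, ℓ t f₀)
      ≤ Real.log F.card + T * (η ^ 2 / 8) := by
  have h1 := log_mwProb (η := η) (ℓ := ℓ) hF f₀ T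
  have h2 : Real.log (mwProb F η ℓ T f₀) ≤ 0 := by
    refine Real.log_nonpos (mwProb_pos hF T f₀).le ?_
    rw [← sum_mwProb (η := η) (ℓ := ℓ) hF T]
    exact Finset.single_le_sum (fun f _ => (mwProb_pos hF T f).le) hf₀
  have h3 := Finset.sum_le_sum fun t (_ : t ∈ Finset.range T) =>
    log_normalizer_le (η := η) hF hℓ t
  rw [Finset.sum_add_distrib, ← Finset.mul_sum, Finset.sum_const, Finset.card_range,
    nsmul_eq_mul] at h3
  linarith

/-- The regret bound of Multiplicative Weights for the optimal learning rate. -/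
theorem mw_regret (hℓ : ∀ t f, ℓ t f = 0 ∨ ℓ t f = 1) {f₀ : ι} (hf₀ : f₀ ∈ F) (T : ℕ)
    (hη : η = Real.sqrt (8 * Real.log F.card / T)) :
    ∑ t ∈ Finset.range T, ∑ f ∈ F, mwProb F η ℓ t f * ℓ t f - ∑ t ∈ Finset.range T, ℓ t f₀
      ≤ Real.sqrt (T * Real.log F.card / 2) := by
  have hF : F.Nonempty := ⟨f₀, hf₀⟩
  rcases Nat.eq_zero_or_pos T with rfl | hT
  · simp
  have hT' : (0 : ℝ) < T := by exact_mod_cast hT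
  -- A single expert gives `η = 0`, where the general bound says nothing; the regret is then exactly
  -- zero.
  rcases (Nat.one_le_iff_ne_zero.2 hF.card_pos.ne').eq_or_lt with h1 | h1
  · obtain ⟨a, ha⟩ := Finset.card_eq_one.1 h1.symm
    have haf : f₀ = a := by rw [ha] at hf₀; simpa using hf₀
    have hp : ∀ t, mwProb F η ℓ t a = 1 := by
      intro t
      have := sum_mwProb (η := η) (ℓ := ℓ) hF t
      rw [ha] at this ⊢
      simpa using this
    have h2 : ∀ t, ∑ f ∈ F, mwProb F η ℓ t f * ℓ t f = ℓ t a := by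
      intro t
      rw [Finset.sum_eq_single_of_mem a (by rw [ha]; simp) fun b hb hne => ?_, hp, one_mul]
      rw [ha] at hb
      exact absurd (by simpa using hb) hne
    simp_rw [h2, haf]
    rw [sub_self]
    positivity
  · have hlog : 0 < Real.log F.card := Real.log_pos (by exact_mod_cast h1)
    have hη0 : 0 < η := by rw [hη]; exact Real.sqrt_pos.2 (by positivity)
    have hη2 : η ^ 2 = 8 * Real.log F.card / T := by
      rw [hη, Real.sq_sqrt (by positivity)]
    have hlog2 : Real.log F.card = η ^ 2 * T / 8 := by rw [hη2]; field_simp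
    have h := mw_regret_rate (η := η) hF hℓ hf₀ T
    have h3 : Real.sqrt (T * Real.log F.card / 2) = η * T / 4 := by
      rw [hlog2, show T * (η ^ 2 * T / 8) / 2 = (η * T / 4) ^ 2 by ring,
        Real.sqrt_sq (by positivity)]
    rw [h3]
    refine le_of_mul_le_mul_left (h.trans_eq ?_) hη0
    rw [hlog2]; ring

end MultiplicativeWeights

/-! ### Counting the experts and charging mistakes to losses -/

section Experts

variable {d : ℕ} {H : Set (Euc d → Label)} {σ : ℝ} {Z : Finset (Euc d)} {M : ℕ}
  {z : Z → Fin M → Euc d}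

lemma mem_experts_of_mem {h : Euc d → Label} (hh : h ∈ H) :
    (fun p : noisyPoints σ Z M z => h p) ∈ experts H σ Z M z := by
  rw [experts, Set.Finite.mem_toFinset]
  exact ⟨h, hh, rfl⟩

-- Traces are indexed by pairs, since different pairs may give the same noisy point; an expert is
-- still determined by its trace.
open Finset in
open scoped Classical in
lemma card_experts_le_card_traces :
    (experts H σ Z M z).card ≤
      (traces H fun k : Z × Fin M => (k.1 : Euc d) + σ • z k.1 k.2).card := by
  refine card_le_card_of_injOn (fun g => univ.filter fun k => g (noisyPoint σ Z M z k.1 k.2) = 1)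
    (fun g hg => ?_) fun g hg g' hg' hgg' => ?_
  · rw [mem_coe, experts, Set.Finite.mem_toFinset] at hg
    obtain ⟨h, hh, rfl⟩ := hg
    exact mem_coe.2 (mem_filter.2 ⟨mem_univ _, h, hh, rfl⟩)
  · funext ⟨p, k, hk⟩
    have hp : (⟨p, k, hk⟩ : noisyPoints σ Z M z) = noisyPoint σ Z M z k.1 k.2 :=
      Subtype.ext hk.symm
    rw [hp]
    have := Finset.ext_iff.1 hgg' k
    simp only [mem_filter, mem_univ, true_and] at this
    by_cases h1 : g (noisyPoint σ Z M z k.1 k.2) = 1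
    · rw [h1, this.1 h1]
    · rw [(label_ne_one_iff _).1 h1, (label_ne_one_iff _).1 (mt this.2 h1)]

lemma card_experts_le (hH : vcDim H ≠ ⊤) {x : ℝ} (hx : 0 < x) (hx1 : x ≤ 1) :
    ((experts H σ Z M z).card : ℝ)
      ≤ (1 / x) ^ (vcDim H).toNat * Real.exp (x * (Z.card * M)) := by
  classical
  have h := card_le_of_vcDim_le (vcDim_traces_le hH
    fun k : Z × Fin M => (k.1 : Euc d) + σ • z k.1 k.2) hx hx1
  rw [Fintype.card_prod, Fintype.card_coe, Fintype.card_fin, Nat.cast_mul] at h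
  refine le_trans ?_ h
  exact_mod_cast card_experts_le_card_traces

-- The case `v = 0` is separate because there `M` is bounded through `max v 1`, and the exponential
-- bound would not give a single expert.
open Finset in
lemma card_experts_le_one (hH : vcDim H ≠ ⊤) (hv : (vcDim H).toNat = 0) :
    (experts H σ Z M z).card ≤ 1 := by
  classical
  refine card_experts_le_card_traces.trans ((card_le_card_shatterer _).trans
    (card_shatterer_le_sum_vcDim.trans ?_))
  have h := vcDim_traces_le hH fun k : Z × Fin M => (k.1 : Euc d) + σ • z k.1 k.2
  rw [hv, Nat.le_zero] at h
  rw [h]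
  simp [show Iic 0 = ({0} : Finset ℕ) from rfl]

/-- A mistake of the prediction of an expert is charged to its loss. -/
lemma mistake_le_loss (hM : 0 < M) (g : noisyPoints σ Z M z → Label) (x' : Z) (y : Label) :
    (if predict σ Z M z g x' ≠ y then (1 : ℝ) else 0) ≤ loss σ Z M z g x' y := by
  have hM' : (M : ℝ) ≠ 0 := by exact_mod_cast hM.ne'
  have hsum : 1 / (M : ℝ) * ∑ i, (if g (noisyPoint σ Z M z x' i) = 1 then (1 : ℝ) else 0)
      + 1 / (M : ℝ) * ∑ i, (if g (noisyPoint σ Z M z x' i) ≠ 1 then (1 : ℝ) else 0) = 1 := by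
    rw [← mul_add, ← Finset.sum_add_distrib]
    have : ∀ i : Fin M, (if g (noisyPoint σ Z M z x' i) = 1 then (1 : ℝ) else 0)
        + (if g (noisyPoint σ Z M z x' i) ≠ 1 then (1 : ℝ) else 0) = 1 := by
      intro i; by_cases h : g (noisyPoint σ Z M z x' i) = 1 <;> simp [h]
    simp_rw [this]
    simp [hM']
  -- Ties predict `1`: for `y = -1` mistake and loss coincide, while for `y = 1` a tie is a loss
  -- without a mistake.
  rcases Int.units_eq_one_or y with rfl | rfl
  · unfold predict loss
    by_cases h : 1 / 2 ≤ 1 / (M : ℝ) *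
      ∑ i, (if g (noisyPoint σ Z M z x' i) = 1 then (1 : ℝ) else 0)
    · rw [if_pos h, if_neg (by simp)]; split_ifs <;> norm_num
    · rw [if_neg h, if_pos (by decide), if_pos (by linarith)]
  · have hiff : ∀ i, (g (noisyPoint σ Z M z x' i) ≠ -1) = (g (noisyPoint σ Z M z x' i) = 1) := by
      intro i
      rcases Int.units_eq_one_or (g (noisyPoint σ Z M z x' i)) with h | h <;> rw [h] <;> decide
    unfold predict loss
    simp_rw [hiff]
    by_cases h : 1 / 2 ≤ 1 / (M : ℝ) *
      ∑ i, (if g (noisyPoint σ Z M z x' i) = 1 then (1 : ℝ) else 0)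
    · rw [if_pos h, if_pos (by decide), if_pos h]
    · rw [if_neg h, if_neg (by simp), if_neg h]

end Experts

/-! ### Losses against the smoothed benchmark -/

section Comparison

variable {d : ℕ}

lemma Label.toReal_eq (y : Label) : y.toReal = 2 * (if y = 1 then 1 else 0) - 1 := by
  rcases Int.units_eq_one_or y with rfl | rfl
  · norm_num [Label.toReal]
  · norm_num [Label.toReal]

lemma Label.abs_toReal (y : Label) : |y.toReal| = 1 := by
  rcases Int.units_eq_one_or y with rfl | rfl <;> simp [Label.toReal]

lemma Label.toReal_mul (y y' : Label) :
    y.toReal * y'.toReal = 1 - 2 * (if y' ≠ y then 1 else 0) := by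
  rcases Int.units_eq_one_or y with rfl | rfl <;> rcases Int.units_eq_one_or y' with rfl | rfl <;>
    norm_num [Label.toReal]

lemma aemeasurable_toReal {μ : Measure (Euc d)} {h : Euc d → Label}
    (hm : NullMeasurableSet {x | h x = 1} μ) : AEMeasurable (fun x => (h x).toReal) μ := by
  have : (fun x => (h x).toReal) = fun x => 2 * ({x | h x = 1}.indicator 1 x : ℝ) - 1 := by
    ext x; rw [Label.toReal_eq]; simp [Set.indicator_apply]
  rw [this]
  exact ((aemeasurable_one.indicator₀ hm).const_mul 2).sub_const 1

lemma integral_toReal {μ : Measure (Euc d)} [IsProbabilityMeasure μ] {h : Euc d → Label}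
    (hm : NullMeasurableSet {x | h x = 1} μ) (y : Label) :
    y.toReal * ∫ x, (h x).toReal ∂μ = 2 * μ.real {x | h x = y} - 1 := by
  have hy : NullMeasurableSet {x | h x = y} μ := by
    rcases Int.units_eq_one_or y with rfl | rfl
    · exact hm
    · have : {x | h x = -1} = {x | h x = 1}ᶜ := by
        ext x; exact (label_ne_one_iff (h x)).symm
      rw [this]; exact hm.compl
  rw [← integral_const_mul]
  have : ∀ x, y.toReal * (h x).toReal = 2 * ({x | h x = y}.indicator 1 x : ℝ) - 1 := by
    intro x
    rw [Label.toReal_mul]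
    by_cases hxy : h x = y <;> norm_num [hxy, Set.indicator_apply]
  simp_rw [this]
  have hi : Integrable ({x | h x = y}.indicator (1 : Euc d → ℝ)) μ :=
    (integrable_const (1 : ℝ)).indicator₀ hy
  rw [integral_sub (hi.const_mul 2) (integrable_const _), integral_const_mul,
    integral_indicator₀ hy]
  simp [measureReal_def]

/-- From `√(2 / π) ≥ 3 / 4`. A shift of norm `ε / 3` then costs `3 / 2 * (ε / 3) = ε / 2`. -/
lemma coverScale_le {σ ε : ℝ} (hσ : 0 < σ) (hε : 0 < ε) : coverScale σ ε ≤ σ * (ε / 3) := by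
  have h1 : 3 / 4 ≤ Real.sqrt (2 / Real.pi) := by
    refine Real.le_sqrt_of_sq_le ?_
    rw [le_div_iff₀ Real.pi_pos]
    have := Real.pi_lt_d2
    linarith
  rw [coverScale, div_le_iff₀ (by linarith)]
  have : σ * (ε / 3) * (3 / 4) ≤ σ * (ε / 3) * Real.sqrt (2 / Real.pi) := by gcongr
  linarith

/-- The loss of the restriction of a hypothesis is at most the benchmark's indicator. -/
lemma loss_le_indicator {H : Set (Euc d → Label)} (hm : MeasurableClass H) {σ ε K : ℝ}
    (hσ : 0 < σ) (hε : 0 < ε) {Z : Finset (Euc d)} {M : ℕ} {z : Z → Fin M → Euc d}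
    (hz : IsGaussApprox H σ ε K Z M z) {h : Euc d → Label} (hh : h ∈ H) {x : Euc d} {x' : Z}
    (hx : dist x x' ≤ coverScale σ ε) (y : Label) :
    loss σ Z M z (fun p => h p) x' y ≤
      if y.toReal * ∫ u, (h (x + σ • u)).toReal ∂(stdGaussian (Euc d)) ≤ ε then 1 else 0 := by
  have hac := stdGaussian_absolutelyContinuous d
  have hnm : ∀ a : Euc d, NullMeasurableSet {u | h (a + σ • u) = 1} volume := fun a =>
    (hm.1 h hh).preimage (quasiMeasurePreserving_affine a hσ.ne')
  by_cases hle : y.toReal * ∫ u, (h (x + σ • u)).toReal ∂(stdGaussian (Euc d)) ≤ ε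
  · rw [if_pos hle, loss]; split_ifs <;> norm_num
  rw [if_neg hle, loss, if_neg]
  intro hhalf
  apply hle
  -- For `ε ≥ 1` the benchmark's indicator is always `1`; below, the smoothing estimate needs `ε / 3
  -- ≤ 1`.
  rcases le_or_gt 1 ε with h1 | h1
  · rw [integral_toReal ((hnm x).mono_ac hac)]
    have : (stdGaussian (Euc d)).real {u | h (x + σ • u) = y} ≤ 1 := measureReal_le_one
    linarith
  have hM : (0 : ℝ) < M := by exact_mod_cast hz.1
  -- A loss means that at most half of the noisy points carry `y`, so the Gaussian probability at
  -- `x'` is at most `1 / 2 + ε / 4` and the margin there at most `ε / 2`.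
  have hcover := (abs_le.1 (hz.2.2 x' y h hh)).2
  have hsum : 1 / (M : ℝ) * ∑ i, (if h ((x' : Euc d) + σ • z x' i) = y then (1 : ℝ) else 0)
      + 1 / (M : ℝ) * ∑ i, (if h ((x' : Euc d) + σ • z x' i) ≠ y then (1 : ℝ) else 0) = 1 := by
    rw [← mul_add, ← Finset.sum_add_distrib]
    have : ∀ i : Fin M, (if h ((x' : Euc d) + σ • z x' i) = y then (1 : ℝ) else 0)
        + (if h ((x' : Euc d) + σ • z x' i) ≠ y then (1 : ℝ) else 0) = 1 := by
      intro i; by_cases h : h ((x' : Euc d) + σ • z x' i) = y <;> simp [h]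
    simp_rw [this]
    simp [hM.ne']
  have hhalf' : 1 / 2 ≤ 1 / (M : ℝ) *
      ∑ i, (if h ((x' : Euc d) + σ • z x' i) ≠ y then (1 : ℝ) else 0) := hhalf
  have hbase := integral_toReal ((hnm (x' : Euc d)).mono_ac hac) y
  set w : Euc d := σ⁻¹ • (x - x') with hw
  have hwn : ‖w‖ ≤ ε / 3 := by
    rw [hw, norm_smul, norm_inv, Real.norm_of_nonneg hσ.le, ← dist_eq_norm,
      inv_mul_le_iff₀ hσ]
    exact hx.trans (coverScale_le hσ hε)
  have hshift := abs_integral_shift_sub_le (f := fun u => (h ((x' : Euc d) + σ • u)).toReal)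
    (aemeasurable_toReal (hnm x')) (fun u => (Label.abs_toReal _).le) hwn (by positivity)
    (by linarith)
  have hxw : ∀ u, (x' : Euc d) + σ • (w + u) = x + σ • u := by
    intro u
    rw [hw, smul_add, smul_inv_smul₀ hσ.ne']; abel
  simp_rw [hxw] at hshift
  have hdiff : y.toReal * ∫ u, (h (x + σ • u)).toReal ∂(stdGaussian (Euc d))
      - y.toReal * ∫ u, (h ((x' : Euc d) + σ • u)).toReal ∂(stdGaussian (Euc d)) ≤ ε / 2 := by
    rw [← mul_sub]
    refine (le_abs_self _).trans ?_
    rw [abs_mul, Label.abs_toReal, one_mul]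
    linarith
  rw [hbase] at hdiff
  linarith

end Comparison

/-! ### The regret of the algorithm -/

section Regret

variable {d : ℕ} {X : Set (Euc d)} {H : Set (Euc d → Label)} {σ ε : ℝ} {Z : Finset (Euc d)}
  {φ : X → Z} {M : ℕ} {z : Z → Fin M → Euc d}

lemma expectedMistakes_le_card (hne : H.Nonempty) (T : ℕ) (x : ℕ → X) (y : ℕ → Label) :
    expectedMistakes H σ Z φ M z T x y ≤ T := by
  obtain ⟨h, hh⟩ := hne
  have hF : (experts H σ Z M z).Nonempty := ⟨_, mem_experts_of_mem hh⟩
  calc expectedMistakes H σ Z φ M z T x y ≤ ∑ t ∈ Finset.range T, (1 : ℝ) := by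
        refine Finset.sum_le_sum fun t _ => ?_
        refine le_of_le_of_eq (Finset.sum_le_sum fun g _ =>
          mul_le_of_le_one_right (mwProb_pos hF t g).le ?_) (sum_mwProb hF t)
        split_ifs <;> norm_num
    _ = T := by simp

lemma exists_optGauss_eq (hne : H.Nonempty) (T : ℕ) (x : ℕ → Euc d) (y : ℕ → Label) :
    ∃ h ∈ H, optGauss H σ ε T x y = ∑ t ∈ Finset.range T,
      if (y t).toReal * ∫ u, (h (x t + σ • u)).toReal ∂(stdGaussian (Euc d)) ≤ ε
        then 1 else 0 := by
  obtain ⟨h, hh, hopt⟩ := Nat.sInf_mem (hne.image fun h : Euc d → Label =>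
    ∑ t ∈ Finset.range T,
      if (y t).toReal * ∫ u, (h (x t + σ • u)).toReal ∂(stdGaussian (Euc d)) ≤ ε
        then 1 else 0)
  exact ⟨h, hh, hopt.symm⟩

lemma regret_le_sqrt_log_card (hne : H.Nonempty) (hm : MeasurableClass H) {K : ℝ}
    (hσ : 0 < σ) (hε : 0 < ε)
    (hφ : ∀ x : X, dist (x : Euc d) (φ x) ≤ coverScale σ ε)
    (hz : IsGaussApprox H σ ε K Z M z) (T : ℕ) (x : ℕ → X) (y : ℕ → Label) :
    expectedMistakes H σ Z φ M z T x y
        - (optGauss H σ ε T (fun t => (x t : Euc d)) y : ℝ)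
      ≤ Real.sqrt (T * Real.log (experts H σ Z M z).card / 2) := by
  obtain ⟨h, hh, hopt⟩ := exists_optGauss_eq (σ := σ) (ε := ε) hne T (fun t => (x t : Euc d)) y
  have hF : (experts H σ Z M z).Nonempty := ⟨_, mem_experts_of_mem hh⟩
  have hmw := mw_regret (η := rate H σ Z M z T)
    (ℓ := fun s g' => loss σ Z M z g' (φ (x s)) (y s))
    (fun t g => by simp only [loss]; split_ifs <;> simp)
    (mem_experts_of_mem (σ := σ) (z := z) hh) T rfl
  have h1 : expectedMistakes H σ Z φ M z T x y ≤ ∑ t ∈ Finset.range T,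
      ∑ g ∈ experts H σ Z M z, mwProb (experts H σ Z M z) (rate H σ Z M z T)
        (fun s g' => loss σ Z M z g' (φ (x s)) (y s)) t g * loss σ Z M z g (φ (x t)) (y t) :=
    Finset.sum_le_sum fun t _ => Finset.sum_le_sum fun g _ =>
      mul_le_mul_of_nonneg_left (mistake_le_loss hz.1 g _ _) (mwProb_pos hF t g).le
  have h2 : ∑ t ∈ Finset.range T, loss σ Z M z (fun p => h p) (φ (x t)) (y t)
      ≤ (optGauss H σ ε T (fun t => (x t : Euc d)) y : ℝ) := by
    rw [hopt, Nat.cast_sum]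
    refine Finset.sum_le_sum fun t _ => ?_
    push_cast
    exact loss_le_indicator hm hσ hε hz hh (hφ (x t)) (y t)
  linarith

lemma log_card_experts_le (hne : H.Nonempty) (hH : vcDim H ≠ ⊤) (hε : 0 < ε) (hε1 : ε ≤ 1)
    (hZ : Z.Nonempty) (hz : IsGaussApprox H σ ε 2000 Z M z) :
    Real.log (experts H σ Z M z).card
      ≤ (vcDim H).toNat * Real.log (32001 * Real.exp 1 * Z.card / ε ^ 2) := by
  obtain ⟨h, hh⟩ := hne
  have hF : (0 : ℝ) < (experts H σ Z M z).card := by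
    exact_mod_cast Finset.card_pos.2 ⟨_, mem_experts_of_mem (σ := σ) (z := z) hh⟩
  have hZ' : (1 : ℝ) ≤ Z.card := by exact_mod_cast hZ.card_pos
  rcases Nat.eq_zero_or_pos (vcDim H).toNat with hv | hv
  · rw [hv, Nat.cast_zero, zero_mul]
    exact Real.log_nonpos hF.le (by exact_mod_cast card_experts_le_one hH hv)
  have hv1 : (1 : ℝ) ≤ (vcDim H).toNat := by exact_mod_cast hv
  have hε2 : ε ^ 2 ≤ 1 := pow_le_one₀ hε.le hε1
  -- Here `32001 = 16 * 2000 + 1`: the `16` comes from `(ε / 4)²`, the `1` from rounding up.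
  have hM : (M : ℝ) ≤ 32001 * (vcDim H).toNat / ε ^ 2 := by
    have h1 : (M : ℝ) ≤ (⌈2000 * (max (vcDim H).toNat 1 : ℕ) / (ε / 4) ^ 2⌉₊ : ℝ) := by
      exact_mod_cast hz.2.1
    rw [max_eq_left hv] at h1
    have h2 := Nat.ceil_lt_add_one (a := 2000 * ((vcDim H).toNat : ℝ) / (ε / 4) ^ 2)
      (by positivity)
    have h3 : 2000 * ((vcDim H).toNat : ℝ) / (ε / 4) ^ 2 = 32000 * (vcDim H).toNat / ε ^ 2 := by
      field_simp; ring
    have h4 : 1 ≤ ((vcDim H).toNat : ℝ) / ε ^ 2 := by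
      rw [le_div_iff₀ (by positivity)]; linarith
    have h5 : 32001 * ((vcDim H).toNat : ℝ) / ε ^ 2
        = 32000 * (vcDim H).toNat / ε ^ 2 + (vcDim H).toNat / ε ^ 2 := by ring
    linarith
  -- Chosen so that `x |Z| M ≤ v`; this exponent becomes the factor `e` inside the logarithm.
  set x : ℝ := ε ^ 2 / (32001 * Z.card) with hx
  have hx0 : 0 < x := by positivity
  have hx1 : x ≤ 1 := by rw [hx, div_le_one (by positivity)]; linarith
  have hcard := Real.log_le_log hF (card_experts_le (σ := σ) (z := z) hH hx0 hx1)
  rw [Real.log_mul (by positivity) (by positivity), Real.log_exp, Real.log_pow] at hcard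
  have h6 : x * (Z.card * M) ≤ (vcDim H).toNat := by
    calc x * (Z.card * M) ≤ x * (Z.card * (32001 * (vcDim H).toNat / ε ^ 2)) := by gcongr
      _ = (vcDim H).toNat := by rw [hx]; field_simp
  have h7 : Real.log (32001 * Real.exp 1 * Z.card / ε ^ 2) = Real.log (1 / x) + 1 := by
    have : 32001 * Real.exp 1 * Z.card / ε ^ 2 = (1 / x) * Real.exp 1 := by
      rw [hx]; field_simp
    rw [this, Real.log_mul (by positivity) (by positivity), Real.log_exp]
  rw [h7, mul_add, mul_one]
  linarith

/-- The regret of the algorithm, for every choice of a cover and of noisy points. -/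
theorem regret_le (hne : H.Nonempty) (hm : MeasurableClass H) (hH : vcDim H ≠ ⊤)
    (hσ : 0 < σ) (hε : 0 < ε)
    (hφ : ∀ x : X, dist (x : Euc d) (φ x) ≤ coverScale σ ε)
    (hz : IsGaussApprox H σ ε 2000 Z M z) (T : ℕ) (x : ℕ → X) (y : ℕ → Label) :
    expectedMistakes H σ Z φ M z T x y
        - (optGauss H σ ε T (fun t => (x t : Euc d)) y : ℝ)
      ≤ regretBound 32001 ε T (vcDim H).toNat Z.card := by
  -- For `ε ≥ 1` the benchmark equals `T`, so the regret is nonpositive whatever the sign of the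
  -- logarithm.
  rcases le_or_gt 1 ε with h1 | h1
  · obtain ⟨h, hh, hopt⟩ := exists_optGauss_eq (σ := σ) (ε := ε) hne T
      (fun t => (x t : Euc d)) y
    have h2 : optGauss H σ ε T (fun t => (x t : Euc d)) y = T := by
      rw [hopt]
      calc _ = ∑ t ∈ Finset.range T, 1 := by
            refine Finset.sum_congr rfl fun t _ => if_pos (le_trans ?_ h1)
            have hnm : NullMeasurableSet {u | h ((x t : Euc d) + σ • u) = 1}
                (stdGaussian (Euc d)) :=
              ((hm.1 h hh).preimage (quasiMeasurePreserving_affine _ hσ.ne')).mono_ac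
                (stdGaussian_absolutelyContinuous d)
            rw [integral_toReal hnm]
            have : (stdGaussian (Euc d)).real {u | h ((x t : Euc d) + σ • u) = y t} ≤ 1 :=
              measureReal_le_one
            linarith
        _ = T := by simp
    rw [h2]
    have h3 : 0 ≤ regretBound 32001 ε T (vcDim H).toNat Z.card := Real.sqrt_nonneg _
    linarith [expectedMistakes_le_card (σ := σ) (φ := φ) (z := z) hne T x y]
  · refine (regret_le_sqrt_log_card hne hm hσ hε hφ hz T x y).trans (Real.sqrt_le_sqrt ?_)
    -- The sequence is infinite, so `x 0` witnesses that `Z` is nonempty even for `T = 0`.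
    have hlog := log_card_experts_le hne hH hε h1.le ⟨_, (φ (x 0)).2⟩ hz
    have h0 : 0 ≤ Real.log (experts H σ Z M z).card := Real.log_natCast_nonneg _
    rw [mul_assoc, mul_div_assoc]
    gcongr
    linarith

end Regret

/-! ### Minimal covers and the main theorem -/

lemma coverScale_eq (σ ε : ℝ) : coverScale σ ε = Real.sqrt (Real.pi / 32) * σ * ε := by
  have h1 : Real.sqrt (Real.pi / 32) * Real.sqrt (2 / Real.pi) = 1 / 4 := by
    rw [← Real.sqrt_mul (by positivity), show Real.pi / 32 * (2 / Real.pi) = (1 / 4) ^ 2 by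
      field_simp; norm_num, Real.sqrt_sq (by norm_num)]
  have h2 : 0 < Real.sqrt (2 / Real.pi) := Real.sqrt_pos.2 (by positivity)
  rw [coverScale, div_eq_iff h2.ne']
  linear_combination -(σ * ε) * h1

/-- A minimal cover, as a finite set with a map to it. -/
lemma exists_cover_of_coveringNumber {d : ℕ} {X : Set (Euc d)} {r : ℝ} (hr : 0 ≤ r) {N : ℕ}
    (h : Metric.coveringNumber r.toNNReal X = (N : ℕ∞)) :
    ∃ (Z : Finset (Euc d)) (φ : X → Z), (Z : Set (Euc d)) ⊆ X ∧ Z.card = N ∧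
      ∀ x : X, dist (x : Euc d) (φ x) ≤ r := by
  obtain ⟨C, hCX, hCfin, hCcov, hCcard⟩ :=
    Metric.exists_set_encard_eq_coveringNumber (by rw [h]; exact ENat.natCast_ne_top N)
  have hφ : ∀ x : X, ∃ c : hCfin.toFinset, dist (x : Euc d) c ≤ r := by
    intro x
    obtain ⟨c, hc, hxc⟩ := hCcov x.2
    refine ⟨⟨c, hCfin.mem_toFinset.2 hc⟩, ?_⟩
    have hxc' : edist (x : Euc d) c ≤ (r.toNNReal : ENNReal) := hxc
    rw [edist_dist, ← ENNReal.ofReal, ENNReal.ofReal_le_ofReal_iff hr] at hxc'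
    exact hxc'
  choose φ hφ using hφ
  refine ⟨hCfin.toFinset, φ, by simpa using hCX, ?_, hφ⟩
  rw [h, hCfin.encard_eq_coe_toFinset_card] at hCcard
  exact_mod_cast hCcard

end GaussSmooth

theorem mainTheorem3 :
    ∃ K c : ℝ, 0 < K ∧ 0 < c ∧
      ∀ (d : ℕ) (X : Set (GaussSmooth.Euc d)) (σ ε : ℝ), 0 < σ → 0 < ε →
      ∀ H : Set (GaussSmooth.Euc d → GaussSmooth.Label), H.Nonempty →
        GaussSmooth.MeasurableClass H → GaussSmooth.vcDim H ≠ ⊤ →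
      -- every finite cover, every way of mapping `X` to it, every choice of noise points
      (∀ (Z : Finset (GaussSmooth.Euc d)) (φ : X → Z),
        (∀ x : X, dist (x : GaussSmooth.Euc d) (φ x) ≤ GaussSmooth.coverScale σ ε) →
        (∃ (M : ℕ) (z : Z → Fin M → GaussSmooth.Euc d),
          GaussSmooth.IsGaussApprox H σ ε K Z M z) ∧
        ∀ (M : ℕ) (z : Z → Fin M → GaussSmooth.Euc d),
          GaussSmooth.IsGaussApprox H σ ε K Z M z →
          ∀ (T : ℕ) (x : ℕ → X) (y : ℕ → GaussSmooth.Label),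
            GaussSmooth.expectedMistakes H σ Z φ M z T x y
                - (GaussSmooth.optGauss H σ ε T (fun t => (x t : GaussSmooth.Euc d)) y : ℝ)
              ≤ GaussSmooth.regretBound c ε T (GaussSmooth.vcDim H).toNat Z.card) ∧
      -- with a cover of minimum size the bound is in terms of the covering number
      (∀ N : ℕ,
        Metric.coveringNumber (Real.toNNReal (Real.sqrt (Real.pi / 32) * σ * ε)) X = (N : ℕ∞) →
        ∃ (Z : Finset (GaussSmooth.Euc d)) (φ : X → Z),
          (Z : Set (GaussSmooth.Euc d)) ⊆ X ∧ Z.card = N ∧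
          (∀ x : X, dist (x : GaussSmooth.Euc d) (φ x) ≤ GaussSmooth.coverScale σ ε) ∧
          (∃ (M : ℕ) (z : Z → Fin M → GaussSmooth.Euc d),
            GaussSmooth.IsGaussApprox H σ ε K Z M z) ∧
          ∀ (M : ℕ) (z : Z → Fin M → GaussSmooth.Euc d),
            GaussSmooth.IsGaussApprox H σ ε K Z M z →
            ∀ (T : ℕ) (x : ℕ → X) (y : ℕ → GaussSmooth.Label),
              GaussSmooth.expectedMistakes H σ Z φ M z T x y
                  - (GaussSmooth.optGauss H σ ε T (fun t => (x t : GaussSmooth.Euc d)) y : ℝ)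
                ≤ GaussSmooth.regretBound c ε T (GaussSmooth.vcDim H).toNat N) := by
  refine ⟨2000, 32001, by norm_num, by norm_num, ?_⟩
  intro d X σ ε hσ hε H hne hm hH
  refine ⟨fun Z φ hφ => ⟨GaussSmooth.exists_isGaussApprox hne hm hH hσ hε Z, fun M z hz =>
    GaussSmooth.regret_le hne hm hH hσ hε hφ hz⟩, fun N hN => ?_⟩
  obtain ⟨Z, φ, hZX, hZN, hφ⟩ := GaussSmooth.exists_cover_of_coveringNumber (by positivity) hN
  rw [← GaussSmooth.coverScale_eq] at hφ
  refine ⟨Z, φ, hZX, hZN, hφ, GaussSmooth.exists_isGaussApprox hne hm hH hσ hε Z,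
    fun M z hz => ?_⟩
  rw [← hZN]
  exact GaussSmooth.regret_le hne hm hH hσ hε hφ hz
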